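/- For $n\ge 0$ let $\mathsf H_n=\sum_{j=1}^n\frac1j$ (so $\mathsf H_0=0$). For $0\le t<1$, define the Legendre–Sun series by \begin{align*} \mathsf S^L_{-1/2}(t)&=2\sum_{k=1}^\infty\binom{2k}k^2\left(\frac{t}{2^4}\right)^{k}(2\mathsf H_{2k}-\mathsf H_k),\\ \mathsf S^L_{-1/3}(t)&=\sum_{k=1}^\infty\binom{2k}k\binom{3k}k\left(\frac{t}{3^3}\right)^{k}(3\mathsf H_{3k}-\mathsf H_k),\\ \mathsf S^L_{-1/4}(t)&=2\sum_{k=1}^\infty\binom{2k}k\binom{4k}{2k}\left(\frac{t}{2^6}\right)^{k}(2\mathsf H_{4k}-\mathsf H_{2k}),\\ \mathsf S^L_{-1/6}(t)&=\sum_{k=1}^\infty\binom{3k}k\binom{6k}{3k}\left(\frac{t}{2^43^3}\right)^{k}(6\mathsf H_{6k}-3\mathsf H_{3k}-2\mathsf H_{2k}+\mathsf H_k). \end{align*} These series converge for $0\le t<1$. Moreover, the following integrals and series all converge absolutely, and \begin{align*} -\int_0^1\mathsf S^L_{-1/2}(t)\log(1-t)\,dt&=2\sum_{k=0}^\infty\frac{\binom{2k}k^2}{2^{4k}}\frac{(2\mathsf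 H_{2k}-\mathsf H_k)\mathsf H_{k+1}}{k+1}\\&=\frac{96}{\pi}-\frac{8\pi}{3}-\frac{128\log2}{\pi}+\frac{64\log^22}{\pi},\\ -\int_0^1\mathsf S^L_{-1/3}(t)\log(1-t)\,dt&=\sum_{k=0}^\infty\frac{\binom{2k}k\binom{3k}k}{3^{3k}}\frac{(3\mathsf H_{3k}-\mathsf H_k)\mathsf H_{k+1}}{k+1}\\&=\frac{567\sqrt3}{8\pi}-\frac{9\sqrt3\,\pi}{4}-\frac{243\sqrt3\log3}{4\pi}+\frac{81\sqrt3\log^23}{4\pi},\\ -\int_0^1\mathsf S^L_{-1/4}(t)\log(1-t)\,dt&=2\sum_{k=0}^\infty\frac{\binom{2k}k\binom{4k}{2k}}{2^{6k}}\frac{(2\mathsf H_{4k}-\mathsf H_{2k})\mathsf H_{k+1}}{k+1}\\&=\frac{3328\sqrt2}{27\pi}-\frac{40\sqrt2\,\pi}{9}-\frac{512\sqrt2\log2}{3\pi}+\frac{96\sqrt2\log^22}{\pi},\\ -\int_0^1\mathsf S^L_{-1/6}(t)\log(1-t)\,dt&=\sum_{k=0}^\infty\frac{\binom{3k}k\binom{6k}{3k}}{2^{4k}3^{3k}}\frac{(6\mathsf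 H_{6k}-3\mathsf H_{3k}-2\mathsf H_{2k}+\mathsf H_k)\mathsf H_{k+1}}{k+1}\\&=\frac{40176}{125\pi}-\frac{66\pi}{5}-\frac{5184\log2}{25\pi}-\frac{3888\log3}{25\pi}\\&\quad+\frac{288\log^22}{5\pi}+\frac{432(\log2)(\log3)}{5\pi}+\frac{162\log^23}{5\pi}. \end{align*} -/

import Mathlib

open Real MeasureTheory

noncomputable section

/-- The `k`-th addend of the Legendre–Sun series of degree `-1/2` (without the prefactor 2). -/
def lsTermHalf (t : ℝ) (k : ℕ) : ℝ :=
  (Nat.choose (2 * k) k : ℝ) ^ 2 * (t / 2 ^ 4) ^ k *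
    (2 * (harmonic (2 * k) : ℝ) - (harmonic k : ℝ))

/-- The Legendre–Sun series of degree `-1/2`; the summation starts at `k = 1`. -/
def legendreSunHalf (t : ℝ) : ℝ :=
  2 * ∑' k : ℕ, lsTermHalf t (k + 1)

/-- The `k`-th addend of the harmonic modulation of that series (without the prefactor 2). -/
def lsHarmonicTermHalf (k : ℕ) : ℝ :=
  (Nat.choose (2 * k) k : ℝ) ^ 2 / (2 : ℝ) ^ (4 * k) *
    ((2 * (harmonic (2 * k) : ℝ) - (harmonic k : ℝ)) * (harmonic (k + 1) : ℝ) / ((k : ℝ) + 1))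

/-- The `k`-th addend of the Legendre–Sun series of degree `-1/3`. -/
def lsTermThird (t : ℝ) (k : ℕ) : ℝ :=
  (Nat.choose (2 * k) k : ℝ) * (Nat.choose (3 * k) k : ℝ) * (t / 3 ^ 3) ^ k *
    (3 * (harmonic (3 * k) : ℝ) - (harmonic k : ℝ))

/-- The Legendre–Sun series of degree `-1/3`; the summation starts at `k = 1`. -/
def legendreSunThird (t : ℝ) : ℝ :=
  ∑' k : ℕ, lsTermThird t (k + 1)

/-- The `k`-th addend of the harmonic modulation of that series. -/
def lsHarmonicTermThird (k : ℕ) : ℝ :=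
  (Nat.choose (2 * k) k : ℝ) * (Nat.choose (3 * k) k : ℝ) / (3 : ℝ) ^ (3 * k) *
    ((3 * (harmonic (3 * k) : ℝ) - (harmonic k : ℝ)) * (harmonic (k + 1) : ℝ) / ((k : ℝ) + 1))

/-- The `k`-th addend of the Legendre–Sun series of degree `-1/4` (without the prefactor 2). -/
def lsTermQuarter (t : ℝ) (k : ℕ) : ℝ :=
  (Nat.choose (2 * k) k : ℝ) * (Nat.choose (4 * k) (2 * k) : ℝ) * (t / 2 ^ 6) ^ k *
    (2 * (harmonic (4 * k) : ℝ) - (harmonic (2 * k) : ℝ))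

/-- The Legendre–Sun series of degree `-1/4`; the summation starts at `k = 1`. -/
def legendreSunQuarter (t : ℝ) : ℝ :=
  2 * ∑' k : ℕ, lsTermQuarter t (k + 1)

/-- The `k`-th addend of the harmonic modulation of that series (without the prefactor 2). -/
def lsHarmonicTermQuarter (k : ℕ) : ℝ :=
  (Nat.choose (2 * k) k : ℝ) * (Nat.choose (4 * k) (2 * k) : ℝ) / (2 : ℝ) ^ (6 * k) *
    ((2 * (harmonic (4 * k) : ℝ) - (harmonic (2 * k) : ℝ)) * (harmonic (k + 1) : ℝ) / ((k : ℝ) + 1))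

/-- The `k`-th addend of the Legendre–Sun series of degree `-1/6`. -/
def lsTermSixth (t : ℝ) (k : ℕ) : ℝ :=
  (Nat.choose (3 * k) k : ℝ) * (Nat.choose (6 * k) (3 * k) : ℝ) * (t / (2 ^ 4 * 3 ^ 3)) ^ k *
    (6 * (harmonic (6 * k) : ℝ) - 3 * (harmonic (3 * k) : ℝ)
      - 2 * (harmonic (2 * k) : ℝ) + (harmonic k : ℝ))

/-- The Legendre–Sun series of degree `-1/6`; the summation starts at `k = 1`. -/
def legendreSunSixth (t : ℝ) : ℝ :=
  ∑' k : ℕ, lsTermSixth t (k + 1)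

/-- The `k`-th addend of the harmonic modulation of that series. -/
def lsHarmonicTermSixth (k : ℕ) : ℝ :=
  (Nat.choose (3 * k) k : ℝ) * (Nat.choose (6 * k) (3 * k) : ℝ) / ((2 : ℝ) ^ (4 * k) * (3 : ℝ) ^ (3 * k)) *
    ((6 * (harmonic (6 * k) : ℝ) - 3 * (harmonic (3 * k) : ℝ)
      - 2 * (harmonic (2 * k) : ℝ) + (harmonic k : ℝ)) * (harmonic (k + 1) : ℝ) / ((k : ℝ) + 1))

end

/-! ### Terms of the hypergeometric series and their logarithmic derivatives -/

section

open Filter Topology Finset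

/-! Each of the four cases is one degree of a single family with parameter `a` = 1/2, 1/3, 1/4, 1/6.
The binomial products are (a)_k (1-a)_k / k!², which is `gaussTerm a 1 k`, and the harmonic brackets
are proportional to `gaussHarm a k`. Since -∫₀¹ t^k log(1-t) dt = H_{k+1}/(k+1) and all terms are
nonnegative, the integral equals the modulated series. The factor 1/(k+1) raises the lower parameter
from 1 to 2, and H_{k+1} = 1 + `shiftHarm 2 k`.

Let F(m) = ₂F₁(a, 1-a; m; 1), and regard `gaussTerm a m k` / F(m) as a probability distribution in
k. The means of `gaussHarm` and `shiftHarm`, and their covariance, are up to sign first and mixed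
second derivatives of log F, so Gauss's formula predicts digamma and trigamma values. At m = 2 the
mean of `shiftHarm` is the mean G of `gaussHarm` minus 1, hence the series is F(2) (Cov + G²)
(`hasSum_gauss_harmonic`).

No differentiation is carried out. Contiguity and telescoping in k give exact recursions from m to
m+1 for F, both means and the covariance (`gaussMoment_one_succ`, `gaussHarm_ratio_succ`,
`shiftHarm_ratio_succ`, `gaussCov_succ`). As m → ∞ only the term k = 0 survives, so the recursions
sum to the values at m = 2: Euler's sine product for F, and for the rest the limits of `gaussHarm a
N` - 2 H_N and of the sum of inverse squares. For the four values of `a` these limits are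
elementary. -/

/-- The `k`-th term of the hypergeometric series `₂F₁(a, 1 - a; m; 1)`. -/
noncomputable def gaussTerm (a : ℝ) (m k : ℕ) : ℝ :=
  ∏ j ∈ range k, ((j + a) * (j + 1 - a) / ((j + 1) * (j + m)))

/-- The logarithmic derivative of the numerator of `gaussTerm` in a common shift of `a`, `1 - a`. -/
noncomputable def gaussHarm (a : ℝ) (k : ℕ) : ℝ :=
  ∑ j ∈ range k, (1 / (j + a) + 1 / (j + 1 - a))

/-- The harmonic number `1 / m + ⋯ + 1 / (m + k - 1)`. -/
noncomputable def shiftHarm (m k : ℕ) : ℝ := ∑ j ∈ range k, 1 / ((j : ℝ) + m)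

theorem harmonic_cast_eq_sum (k : ℕ) : (harmonic k : ℝ) = ∑ j ∈ range k, 1 / ((j : ℝ) + 1) := by
  simp [harmonic]

theorem harmonic_cast_succ (k : ℕ) : (harmonic (k + 1) : ℝ) = harmonic k + 1 / ((k : ℝ) + 1) := by
  simp [harmonic_succ]

theorem harmonic_cast_nonneg (k : ℕ) : (0 : ℝ) ≤ harmonic k := by
  rw [harmonic_cast_eq_sum]; positivity

theorem gaussTerm_zero (a : ℝ) (m : ℕ) : gaussTerm a m 0 = 1 := by simp [gaussTerm]

theorem gaussTerm_succ (a : ℝ) (m k : ℕ) :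
    gaussTerm a m (k + 1) = gaussTerm a m k * ((k + a) * (k + 1 - a) / ((k + 1) * (k + m))) := by
  exact prod_range_succ _ _

theorem gaussHarm_zero (a : ℝ) : gaussHarm a 0 = 0 := by simp [gaussHarm]

theorem gaussHarm_succ (a : ℝ) (k : ℕ) :
    gaussHarm a (k + 1) = gaussHarm a k + (1 / (k + a) + 1 / (k + 1 - a)) := by
  simp [gaussHarm, sum_range_succ]

theorem shiftHarm_zero (m : ℕ) : shiftHarm m 0 = 0 := by simp [shiftHarm]

theorem shiftHarm_succ (m k : ℕ) : shiftHarm m (k + 1) = shiftHarm m k + 1 / ((k : ℝ) + m) := by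
  simp [shiftHarm, sum_range_succ]

theorem shiftHarm_nonneg (m k : ℕ) : 0 ≤ shiftHarm m k := by
  unfold shiftHarm; positivity

theorem shiftHarm_le_harmonic {m : ℕ} (hm : 1 ≤ m) (k : ℕ) : shiftHarm m k ≤ harmonic k := by
  rw [harmonic_cast_eq_sum]
  have : (1 : ℝ) ≤ m := by exact_mod_cast hm
  unfold shiftHarm
  gcongr

/-- This is how the factor H_{k+1} of the target series enters the moments at m = 2. -/
theorem shiftHarm_two (k : ℕ) : shiftHarm 2 k = harmonic (k + 1) - 1 := by
  induction k with
  | zero => simp [shiftHarm_zero, harmonic]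
  | succ k ih =>
    rw [shiftHarm_succ, ih, harmonic_cast_succ (k + 1)]
    push_cast
    ring

/-- The differences 1/(j+m) - 1/(j+m+1) telescope to 1/m - 1/(m+k). -/
theorem shiftHarm_eq {m : ℕ} (hm : 1 ≤ m) (k : ℕ) :
    shiftHarm m k = shiftHarm (m + 1) k + k / (m * (m + k)) := by
  have h1 : (1 : ℝ) ≤ m := by exact_mod_cast hm
  induction k with
  | zero => simp [shiftHarm_zero]
  | succ k ih =>
    rw [shiftHarm_succ, ih, shiftHarm_succ]
    have : (0 : ℝ) ≤ k := by positivity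
    push_cast
    field_simp
    ring

/-! ### Size of the terms -/

section

variable {a : ℝ}

theorem gaussHarm_nonneg (h0 : 0 < a) (h1 : a < 1) (k : ℕ) : 0 ≤ gaussHarm a k := by
  unfold gaussHarm
  refine sum_nonneg fun j _ => ?_
  have : (0 : ℝ) < j + 1 - a := by linarith [(Nat.cast_nonneg j : (0 : ℝ) ≤ j)]
  positivity

theorem gaussHarm_le_harmonic (h0 : 0 < a) (h1 : a < 1) (k : ℕ) :
    gaussHarm a k ≤ 1 / (a * (1 - a)) * harmonic k := by
  rw [harmonic_cast_eq_sum, mul_sum]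
  unfold gaussHarm
  refine sum_le_sum fun j _ => ?_
  have hj := (Nat.cast_nonneg j : (0 : ℝ) ≤ j)
  have h2 : 0 < 1 - a := by linarith
  have e1 : 1 / ((j : ℝ) + a) ≤ 1 / (a * (j + 1)) := by
    apply one_div_le_one_div_of_le <;> nlinarith
  have e2 : 1 / ((j : ℝ) + 1 - a) ≤ 1 / ((1 - a) * (j + 1)) := by
    apply one_div_le_one_div_of_le <;> nlinarith
  calc _ ≤ 1 / (a * (j + 1)) + 1 / ((1 - a) * (j + 1 : ℝ)) := add_le_add e1 e2
    _ = _ := by field_simp; ring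

theorem gaussTerm_pos (h0 : 0 < a) (h1 : a < 1) {m : ℕ} (hm : 1 ≤ m) (k : ℕ) :
    0 < gaussTerm a m k := by
  unfold gaussTerm
  refine prod_pos fun j _ => ?_
  have : (0 : ℝ) < j + 1 - a := by linarith [(Nat.cast_nonneg j : (0 : ℝ) ≤ j)]
  have : (1 : ℝ) ≤ m := by exact_mod_cast hm
  positivity

/-- Contiguity of the terms in the lower parameter. -/
theorem mul_gaussTerm_eq (a : ℝ) {m : ℕ} (hm : 1 ≤ m) (k : ℕ) :
    m * gaussTerm a m k = gaussTerm a (m + 1) k * (m + k) := by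
  have h1 : (1 : ℝ) ≤ m := by exact_mod_cast hm
  induction k with
  | zero => simp [gaussTerm_zero]
  | succ k ih =>
    have : (0 : ℝ) ≤ k := by positivity
    rw [gaussTerm_succ, gaussTerm_succ, ← mul_assoc, ih]
    push_cast
    field_simp
    ring

/-- Since (k+a)(k+1-a) = k² + k + a(1-a) ≤ (k+1/2)², each ratio of consecutive terms is at most
(k+1)/(k+2). -/
theorem gaussTerm_one_le (h0 : 0 < a) (h1 : a < 1) (k : ℕ) :
    gaussTerm a 1 k ≤ 1 / (k + 1) := by
  induction k with
  | zero => simp [gaussTerm_zero]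
  | succ k ih =>
    rw [gaussTerm_succ]
    have hk := (Nat.cast_nonneg k : (0 : ℝ) ≤ k)
    have h2 : (0 : ℝ) < k + 1 - a := by linarith
    calc _ ≤ 1 / ((k : ℝ) + 1) * ((k + a) * (k + 1 - a) / ((k + 1) * (k + (1 : ℕ)))) := by
            gcongr
      _ ≤ _ := by
        push_cast
        rw [← mul_div_assoc, one_div_mul_eq_div, div_div,
          div_le_div_iff₀ (by positivity) (by positivity)]
        have : ((k : ℝ) + a) * (k + 1 - a) ≤ k ^ 2 + k + 1 / 4 := by
          nlinarith [sq_nonneg (a - 1 / 2)]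
        nlinarith [mul_le_mul_of_nonneg_right this (by positivity : (0 : ℝ) ≤ k + 1 + 1)]

theorem gaussTerm_two_eq (a : ℝ) (k : ℕ) : gaussTerm a 2 k = gaussTerm a 1 k / (k + 1) := by
  have := mul_gaussTerm_eq a le_rfl k
  have h : (0 : ℝ) < k + 1 := by positivity
  rw [eq_div_iff h.ne']
  push_cast at this
  linarith

theorem gaussTerm_antitone (h0 : 0 < a) (h1 : a < 1) {m : ℕ} (hm : 2 ≤ m) (k : ℕ) :
    gaussTerm a m k ≤ gaussTerm a 2 k := by
  unfold gaussTerm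
  have hm' : (2 : ℝ) ≤ m := by exact_mod_cast hm
  refine prod_le_prod (fun j _ => ?_) fun j _ => ?_
  all_goals have : (0 : ℝ) < j + 1 - a := by linarith [(Nat.cast_nonneg j : (0 : ℝ) ≤ j)]
  · positivity
  · push_cast
    gcongr

/-- The gain 2/m comes from the factor j = 0 alone; the other factors only decrease when 2 is
replaced by m. It makes every term with k ≥ 1 vanish as m → ∞. -/
theorem gaussTerm_succ_le (h0 : 0 < a) (h1 : a < 1) {m : ℕ} (hm : 2 ≤ m) (k : ℕ) :
    gaussTerm a m (k + 1) ≤ 2 / m * gaussTerm a 2 (k + 1) := by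
  unfold gaussTerm
  have hm' : (2 : ℝ) ≤ m := by exact_mod_cast hm
  rw [prod_range_succ', prod_range_succ']
  have h2 : 0 < 1 - a := by linarith
  calc _ ≤ (∏ j ∈ range k, ((((j + 1 : ℕ) : ℝ) + a) * ((j + 1 : ℕ) + 1 - a) /
            (((j + 1 : ℕ) + 1) * ((j + 1 : ℕ) + (2 : ℕ))))) *
          ((((0 : ℕ) : ℝ) + a) * ((0 : ℕ) + 1 - a) / (((0 : ℕ) + 1) * ((0 : ℕ) + m))) := by
        push_cast
        have : 0 < 0 + 1 - a := by linarith
        gcongr with j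
        · intro j _
          have : 0 < (j : ℝ) + 1 + 1 - a := by linarith [(Nat.cast_nonneg j : (0 : ℝ) ≤ j)]
          positivity
        · have hj := (Nat.cast_nonneg j : (0 : ℝ) ≤ j)
          exact mul_nonneg (by linarith) (by linarith)
    _ = _ := by
        push_cast
        field_simp
        ring

/-! ### Admissible weights, summability and the limit of large lower parameter -/

/-- A common bound for the weights of the series below. -/
noncomputable def weightBound (a : ℝ) (k : ℕ) : ℝ := (1 + gaussHarm a k) * (1 + harmonic k)

/-- The exponent 1/4 is chosen so that a product of two harmonic weights costs (k+1)^(1/2), which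
leaves the summable (k+1)^(-3/2) against terms of size (k+1)^(-2). -/
theorem harmonic_le_rpow (k : ℕ) : 1 + (harmonic k : ℝ) ≤ 6 * ((k : ℝ) + 1) ^ (1 / 4 : ℝ) := by
  have h1 := harmonic_le_one_add_log (k + 1)
  rw [harmonic_cast_succ] at h1
  have h2 := Real.log_le_rpow_div (x := (k : ℝ) + 1) (ε := 1 / 4) (by positivity) (by norm_num)
  have h3 : 1 ≤ ((k : ℝ) + 1) ^ (1 / 4 : ℝ) :=
    Real.one_le_rpow (by linarith [(Nat.cast_nonneg k : (0 : ℝ) ≤ k)]) (by norm_num)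
  have h4 : 0 ≤ 1 / ((k : ℝ) + 1) := by positivity
  push_cast at h1
  linarith

theorem weightBound_le (h0 : 0 < a) (h1 : a < 1) (k : ℕ) :
    weightBound a k ≤ (1 + 1 / (a * (1 - a))) * 36 * ((k : ℝ) + 1) ^ (1 / 2 : ℝ) := by
  have h2 : 0 < 1 - a := by linarith
  have hH := harmonic_cast_nonneg k
  have e1 := gaussHarm_le_harmonic h0 h1 k
  have hc : 0 < 1 / (a * (1 - a)) := by positivity
  have e2 : 1 + gaussHarm a k ≤ (1 + 1 / (a * (1 - a))) * (1 + harmonic k) := by nlinarith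
  have e3 := harmonic_le_rpow k
  have e4 : ((k : ℝ) + 1) ^ (1 / 2 : ℝ) =
      ((k : ℝ) + 1) ^ (1 / 4 : ℝ) * ((k : ℝ) + 1) ^ (1 / 4 : ℝ) := by
    rw [← Real.rpow_add (by positivity)]; norm_num
  calc weightBound a k
      ≤ ((1 + 1 / (a * (1 - a))) * (1 + harmonic k)) * (1 + harmonic k) := by
        unfold weightBound; gcongr
    _ = (1 + 1 / (a * (1 - a))) * ((1 + harmonic k) * (1 + harmonic k)) := by ring
    _ ≤ (1 + 1 / (a * (1 - a))) * ((6 * ((k : ℝ) + 1) ^ (1 / 4 : ℝ)) *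
          (6 * ((k : ℝ) + 1) ^ (1 / 4 : ℝ))) := by gcongr
    _ = _ := by rw [e4]; ring

theorem one_le_weightBound (h0 : 0 < a) (h1 : a < 1) (k : ℕ) : 1 ≤ weightBound a k := by
  unfold weightBound
  nlinarith [harmonic_cast_nonneg k, gaussHarm_nonneg h0 h1 k]

theorem gaussHarm_le_weightBound (h0 : 0 < a) (h1 : a < 1) (k : ℕ) :
    gaussHarm a k ≤ weightBound a k := by
  unfold weightBound
  nlinarith [harmonic_cast_nonneg k, gaussHarm_nonneg h0 h1 k]

theorem shiftHarm_le_weightBound (h0 : 0 < a) (h1 : a < 1) {m : ℕ} (hm : 1 ≤ m) (k : ℕ) :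
    shiftHarm m k ≤ weightBound a k := by
  unfold weightBound
  nlinarith [harmonic_cast_nonneg k, gaussHarm_nonneg h0 h1 k, shiftHarm_le_harmonic hm k]

theorem mul_le_weightBound (h0 : 0 < a) (h1 : a < 1) {m : ℕ} (hm : 1 ≤ m) (k : ℕ) :
    gaussHarm a k * shiftHarm m k ≤ weightBound a k := by
  unfold weightBound
  have := shiftHarm_le_harmonic hm k
  have := gaussHarm_nonneg h0 h1 k
  have := shiftHarm_nonneg m k
  gcongr <;> linarith

theorem gaussTerm_mul_weightBound_le (h0 : 0 < a) (h1 : a < 1) (k : ℕ) :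
    gaussTerm a 2 k * weightBound a k ≤
      (1 + 1 / (a * (1 - a))) * 36 * ((k : ℝ) + 1) ^ (-(3 / 2) : ℝ) := by
  have hk : (0 : ℝ) < k + 1 := by positivity
  have h2 : 0 < 1 - a := by linarith
  have e1 : gaussTerm a 2 k ≤ ((k : ℝ) + 1) ^ (-2 : ℝ) := by
    rw [gaussTerm_two_eq]
    calc _ ≤ 1 / ((k : ℝ) + 1) / (k + 1) := by
          have := gaussTerm_one_le h0 h1 k
          gcongr
      _ = _ := by
        rw [Real.rpow_neg hk.le, Real.rpow_two]; field_simp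
  have e2 : ((k : ℝ) + 1) ^ (-(3 / 2) : ℝ) =
      ((k : ℝ) + 1) ^ (-2 : ℝ) * ((k : ℝ) + 1) ^ (1 / 2 : ℝ) := by
    rw [← Real.rpow_add hk]; norm_num
  calc _ ≤ ((k : ℝ) + 1) ^ (-2 : ℝ) *
        ((1 + 1 / (a * (1 - a))) * 36 * ((k : ℝ) + 1) ^ (1 / 2 : ℝ)) := by
        have := one_le_weightBound h0 h1 k
        exact mul_le_mul e1 (weightBound_le h0 h1 k) (by linarith) (by positivity)
    _ = _ := by rw [e2]; ring

theorem summable_gaussTerm_mul_weightBound (h0 : 0 < a) (h1 : a < 1) :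
    Summable fun k => gaussTerm a 2 k * weightBound a k := by
  have hs : Summable fun k : ℕ => ((k : ℝ) + 1) ^ (-(3 / 2) : ℝ) := by
    have := (summable_nat_add_iff 1).2
      (Real.summable_nat_rpow (p := -(3 / 2)).2 (by norm_num))
    simpa using this
  refine Summable.of_nonneg_of_le (fun k => ?_) (gaussTerm_mul_weightBound_le h0 h1)
    (hs.mul_left _)
  have := one_le_weightBound h0 h1 k
  have := (gaussTerm_pos h0 h1 one_le_two k).le
  positivity

theorem tendsto_mul_gaussTerm_mul_weightBound (h0 : 0 < a) (h1 : a < 1) :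
    Tendsto (fun k : ℕ => (k : ℝ) * (gaussTerm a 2 k * weightBound a k)) atTop (𝓝 0) := by
  have h2 : 0 < 1 - a := by linarith
  have hlim : Tendsto (fun k : ℕ => (1 + 1 / (a * (1 - a))) * 36 *
      ((k : ℝ) + 1) ^ (-(1 / 2) : ℝ)) atTop (𝓝 0) := by
    have : Tendsto (fun k : ℕ => ((k : ℝ) + 1)) atTop atTop :=
      tendsto_atTop_add_const_right _ _ tendsto_natCast_atTop_atTop
    simpa using ((tendsto_rpow_neg_atTop (y := 1 / 2) (by norm_num)).comp this).const_mul
      ((1 + 1 / (a * (1 - a))) * 36)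
  refine squeeze_zero (fun k => ?_) (fun k => ?_) hlim
  · have := one_le_weightBound h0 h1 k
    have := (gaussTerm_pos h0 h1 one_le_two k).le
    positivity
  · have hk : (0 : ℝ) < k + 1 := by positivity
    have e2 : ((k : ℝ) + 1) ^ (-(1 / 2) : ℝ) = ((k : ℝ) + 1) * ((k : ℝ) + 1) ^ (-(3 / 2) : ℝ) := by
      nth_rewrite 2 [← Real.rpow_one ((k : ℝ) + 1)]
      rw [← Real.rpow_add hk]; norm_num
    calc _ ≤ ((k : ℝ) + 1) * ((1 + 1 / (a * (1 - a))) * 36 * ((k : ℝ) + 1) ^ (-(3 / 2) : ℝ)) := by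
          have := gaussTerm_mul_weightBound_le h0 h1 k
          have hx := one_le_weightBound h0 h1 k
          have hy := (gaussTerm_pos h0 h1 one_le_two k).le
          apply mul_le_mul _ this _ hk.le
          · linarith
          · positivity
      _ = _ := by rw [e2]; ring

/-- A weight that the series `₂F₁(a, 1 - a; m; 1)` with `m ≥ 2` tolerates. -/
def IsWeight (a : ℝ) (w : ℕ → ℝ) : Prop := ∀ k, 0 ≤ w k ∧ w k ≤ weightBound a k

theorem IsWeight.one (h0 : 0 < a) (h1 : a < 1) : IsWeight a fun _ => 1 :=
  fun k => ⟨zero_le_one, one_le_weightBound h0 h1 k⟩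

theorem IsWeight.gaussHarm (h0 : 0 < a) (h1 : a < 1) : IsWeight a (gaussHarm a) :=
  fun k => ⟨gaussHarm_nonneg h0 h1 k, gaussHarm_le_weightBound h0 h1 k⟩

theorem IsWeight.shiftHarm (h0 : 0 < a) (h1 : a < 1) {m : ℕ} (hm : 1 ≤ m) :
    IsWeight a (shiftHarm m) :=
  fun k => ⟨shiftHarm_nonneg m k, shiftHarm_le_weightBound h0 h1 hm k⟩

theorem IsWeight.mul (h0 : 0 < a) (h1 : a < 1) {m : ℕ} (hm : 1 ≤ m) :
    IsWeight a fun k => _root_.gaussHarm a k * _root_.shiftHarm m k :=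
  fun k => ⟨mul_nonneg (gaussHarm_nonneg h0 h1 k) (shiftHarm_nonneg m k),
    mul_le_weightBound h0 h1 hm k⟩

theorem IsWeight.summable {w : ℕ → ℝ} (hw : IsWeight a w) (h0 : 0 < a) (h1 : a < 1)
    {m : ℕ} (hm : 2 ≤ m) : Summable fun k => gaussTerm a m k * w k := by
  refine Summable.of_nonneg_of_le (fun k => ?_) (fun k => ?_)
    (summable_gaussTerm_mul_weightBound h0 h1)
  · exact mul_nonneg (gaussTerm_pos h0 h1 (by omega) k).le (hw k).1
  · exact mul_le_mul (gaussTerm_antitone h0 h1 hm k) (hw k).2 (hw k).1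
      (gaussTerm_pos h0 h1 one_le_two k).le

theorem IsWeight.tendsto {w : ℕ → ℝ} (hw : IsWeight a w) (h0 : 0 < a) (h1 : a < 1)
    {m : ℕ} (hm : 2 ≤ m) : Tendsto (fun k : ℕ => k * (gaussTerm a m k * w k)) atTop (𝓝 0) := by
  refine squeeze_zero (fun k => ?_) (fun k => ?_) (tendsto_mul_gaussTerm_mul_weightBound h0 h1)
  · exact mul_nonneg k.cast_nonneg (mul_nonneg (gaussTerm_pos h0 h1 (by omega) k).le (hw k).1)
  · exact mul_le_mul_of_nonneg_left (mul_le_mul (gaussTerm_antitone h0 h1 hm k) (hw k).2 (hw k).1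
      (gaussTerm_pos h0 h1 one_le_two k).le) k.cast_nonneg

/-- The extra factor k is paid for by the raised lower parameter: by contiguity, k g_{m+1} = m g_m -
m g_{m+1}. -/
theorem IsWeight.summable_mul {w : ℕ → ℝ} (hw : IsWeight a w) (h0 : 0 < a) (h1 : a < 1)
    {m : ℕ} (hm : 2 ≤ m) : Summable fun k => gaussTerm a (m + 1) k * (k * w k) := by
  have e : (fun k : ℕ => gaussTerm a (m + 1) k * (k * w k)) = fun k =>
      m * (gaussTerm a m k * w k) - m * (gaussTerm a (m + 1) k * w k) := by
    ext k
    linear_combination (-w k) * mul_gaussTerm_eq a (m := m) (by omega) k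
  rw [e]
  exact ((hw.summable h0 h1 hm).mul_left _).sub ((hw.summable h0 h1 (by omega)).mul_left _)

/-- Dominated convergence with the majorant at m = 2; the terms with k ≥ 1 are O(1/m). -/
theorem tendsto_tsum_gaussTerm (h0 : 0 < a) (h1 : a < 1) {w : ℕ → ℕ → ℝ}
    (hw : ∀ m, 2 ≤ m → IsWeight a (w m)) {c : ℝ} (hc : ∀ m, w m 0 = c) :
    Tendsto (fun m => ∑' k, gaussTerm a m k * w m k) atTop (𝓝 c) := by
  have := tendsto_tsum_of_dominated_convergence (𝓕 := atTop)
    (f := fun m k => gaussTerm a m k * w m k) (g := fun k => if k = 0 then c else 0)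
    (summable_gaussTerm_mul_weightBound h0 h1) ?_ ?_
  · simpa using this
  · intro k
    cases k with
    | zero => simp [gaussTerm_zero, hc]
    | succ k =>
      simp only [Nat.add_eq_zero_iff, one_ne_zero, and_false, if_false]
      have hlim : Tendsto (fun m : ℕ => 2 / (m : ℝ) *
          (gaussTerm a 2 (k + 1) * weightBound a (k + 1))) atTop (𝓝 0) := by
        simpa using (tendsto_const_div_atTop_nhds_zero_nat (2 : ℝ)).mul_const
          (gaussTerm a 2 (k + 1) * weightBound a (k + 1))
      refine squeeze_zero' ?_ ?_ hlim
      · filter_upwards [eventually_ge_atTop 2] with m hm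
        exact mul_nonneg (gaussTerm_pos h0 h1 (by omega) _).le (hw m hm _).1
      · filter_upwards [eventually_ge_atTop 2] with m hm
        rw [← mul_assoc]
        have := gaussTerm_pos h0 h1 one_le_two (k + 1)
        exact mul_le_mul (gaussTerm_succ_le h0 h1 hm k) (hw m hm _).2 (hw m hm _).1
          (by positivity)
  · filter_upwards [eventually_ge_atTop 2] with m hm k
    have h := mul_nonneg (gaussTerm_pos h0 h1 (by omega : 1 ≤ m) k).le (hw m hm k).1
    rw [Real.norm_of_nonneg h]
    exact mul_le_mul (gaussTerm_antitone h0 h1 hm k) (hw m hm k).2 (hw m hm k).1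
      (gaussTerm_pos h0 h1 one_le_two k).le

end

/-! ### Moments and their linear relations by telescoping -/

theorem tsum_sub_succ_eq_zero {f y : ℕ → ℝ} (hf : Summable f) (hy0 : y 0 = 0)
    (hy : Tendsto y atTop (𝓝 0)) (h : ∀ k, f k = y k - y (k + 1)) : ∑' k, f k = 0 := by
  have h1 := hf.hasSum.tendsto_sum_nat
  simp only [h, sum_range_sub', hy0] at h1
  refine tendsto_nhds_unique ?_ (by simpa using hy.const_sub 0)
  simpa [h] using h1

/-- The moments of `gaussTerm a m` against `1`, `gaussHarm`, `shiftHarm` and their product. -/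
noncomputable def gaussMoment (a : ℝ) (m : ℕ) (w : ℕ → ℝ) : ℝ := ∑' k, gaussTerm a m k * w k

section

variable {a : ℝ}

theorem gaussMoment_contiguous (h0 : 0 < a) (h1 : a < 1) {m : ℕ} (hm : 2 ≤ m) {w : ℕ → ℝ}
    (hw : IsWeight a w) : gaussMoment a m w =
      gaussMoment a (m + 1) w + gaussMoment a (m + 1) (fun k => k * w k) / m := by
  have hm' : (2 : ℝ) ≤ m := by exact_mod_cast hm
  unfold gaussMoment
  rw [← tsum_div_const, ← (hw.summable h0 h1 (by omega)).tsum_add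
    ((hw.summable_mul h0 h1 hm).div_const _)]
  congr 1 with k
  field_simp
  linear_combination w k * mul_gaussTerm_eq a (m := m) (by omega) k

/-- Contiguity rewrites the expression as m k g_m(k) w(k), which still decays because m ≥ 2. -/
theorem tendsto_boundary (h0 : 0 < a) (h1 : a < 1) {m : ℕ} (hm : 2 ≤ m) {w : ℕ → ℝ}
    (hw : IsWeight a w) :
    Tendsto (fun k : ℕ => k * (m + k) * gaussTerm a (m + 1) k * w k) atTop (𝓝 0) := by
  have := (hw.tendsto h0 h1 hm).const_mul (m : ℝ)
  rw [mul_zero] at this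
  refine this.congr fun k => ?_
  linear_combination k * w k * mul_gaussTerm_eq a (m := m) (by omega) k

variable {m : ℕ}

/-- For y_k = k(m+k) g_{m+1}(k) the term ratio gives y_{k+1} = (k+a)(k+1-a) g_{m+1}(k), so the
quadratic parts cancel in y_k - y_{k+1} and ((m-1)k - a(1-a)) g_{m+1}(k) remains. -/
theorem moment_relation_one (h0 : 0 < a) (h1 : a < 1) (hm : 2 ≤ m) :
    (m - 1) * gaussMoment a (m + 1) (fun k => k * 1) =
      a * (1 - a) * gaussMoment a (m + 1) (fun _ => 1) := by
  have s1 := (IsWeight.one h0 h1).summable_mul h0 h1 hm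
  have s0 := (IsWeight.one h0 h1).summable h0 h1 (m := m + 1) (by omega)
  have key := tsum_sub_succ_eq_zero ((s1.mul_left ((m : ℝ) - 1)).sub (s0.mul_left (a * (1 - a))))
    (by simp) (tendsto_boundary h0 h1 hm (IsWeight.one h0 h1)) fun k => by
      have : (2 : ℝ) ≤ m := by exact_mod_cast hm
      have hk : (0 : ℝ) ≤ k := k.cast_nonneg
      rw [gaussTerm_succ]
      push_cast
      field_simp
      ring
  rw [(s1.mul_left _).tsum_sub (s0.mul_left _), tsum_mul_left, tsum_mul_left] at key
  exact sub_eq_zero.1 key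

/-- The previous relation differentiated formally in the common shift of a and 1-a: the increment of
`gaussHarm`, multiplied by (k+a)(k+1-a), contributes 2k+1. -/
theorem moment_relation_gaussHarm (h0 : 0 < a) (h1 : a < 1) (hm : 2 ≤ m) :
    (m - 1) * gaussMoment a (m + 1) (fun k => k * gaussHarm a k) =
      a * (1 - a) * gaussMoment a (m + 1) (gaussHarm a) +
        2 * gaussMoment a (m + 1) (fun k => k * 1) + gaussMoment a (m + 1) (fun _ => 1) := by
  have s1 := (IsWeight.one h0 h1).summable_mul h0 h1 hm
  have s0 := (IsWeight.one h0 h1).summable h0 h1 (m := m + 1) (by omega)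
  have h1' := (IsWeight.gaussHarm h0 h1).summable_mul h0 h1 hm
  have h0' := (IsWeight.gaussHarm h0 h1).summable h0 h1 (m := m + 1) (by omega)
  have key := tsum_sub_succ_eq_zero
    ((((h1'.mul_left ((m : ℝ) - 1)).sub (h0'.mul_left (a * (1 - a)))).sub (s1.mul_left 2)).sub s0)
    (by simp) (tendsto_boundary h0 h1 hm (IsWeight.gaussHarm h0 h1)) fun k => by
      have : (2 : ℝ) ≤ m := by exact_mod_cast hm
      have hk : (0 : ℝ) ≤ k := k.cast_nonneg
      have hk1 : (0 : ℝ) < k + 1 - a := by linarith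
      rw [gaussTerm_succ, gaussHarm_succ]
      push_cast
      field_simp
      ring
  rw [(((h1'.mul_left _).sub (h0'.mul_left _)).sub (s1.mul_left 2)).tsum_sub s0,
    ((h1'.mul_left _).sub (h0'.mul_left _)).tsum_sub (s1.mul_left 2),
    (h1'.mul_left _).tsum_sub (h0'.mul_left _), tsum_mul_left, tsum_mul_left, tsum_mul_left] at key
  unfold gaussMoment
  linarith

theorem moment_relation_shiftHarm (h0 : 0 < a) (h1 : a < 1) (hm : 2 ≤ m) :
    (m - 1) * gaussMoment a (m + 1) (fun k => k * shiftHarm (m + 1) k) =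
      a * (1 - a) * gaussMoment a (m + 1) (shiftHarm (m + 1)) +
        gaussMoment a (m + 1) (fun k => k * 1) := by
  have w := IsWeight.shiftHarm h0 h1 (m := m + 1) (by omega)
  have s1 := (IsWeight.one h0 h1).summable_mul h0 h1 hm
  have h1' := w.summable_mul h0 h1 hm
  have h0' := w.summable h0 h1 (m := m + 1) (by omega)
  have t0 := (IsWeight.one h0 h1).tendsto h0 h1 (m := m + 1) (by omega)
  have key := tsum_sub_succ_eq_zero
    (((h1'.mul_left ((m : ℝ) - 1)).sub (h0'.mul_left (a * (1 - a)))).sub s1)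
    -- The second summand is what differentiating the factor m+k in m produces. Its value at k+1
    -- cancels the increment of `shiftHarm (m + 1)`.
    (y := fun k => k * (m + k) * gaussTerm a (m + 1) k * shiftHarm (m + 1) k -
      k * (gaussTerm a (m + 1) k * 1))
    (by simp) (by simpa using (tendsto_boundary h0 h1 hm w).sub t0) fun k => by
      have : (2 : ℝ) ≤ m := by exact_mod_cast hm
      have hk : (0 : ℝ) ≤ k := k.cast_nonneg
      have hk1 : (0 : ℝ) < k + 1 - a := by linarith
      rw [gaussTerm_succ, shiftHarm_succ]
      push_cast
      field_simp
      ring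
  rw [((h1'.mul_left _).sub (h0'.mul_left _)).tsum_sub s1,
    (h1'.mul_left _).tsum_sub (h0'.mul_left _), tsum_mul_left, tsum_mul_left] at key
  unfold gaussMoment
  linarith

theorem moment_relation_mul (h0 : 0 < a) (h1 : a < 1) (hm : 2 ≤ m) :
    (m - 1) * gaussMoment a (m + 1) (fun k => k * (gaussHarm a k * shiftHarm (m + 1) k)) =
      a * (1 - a) * gaussMoment a (m + 1) (fun k => gaussHarm a k * shiftHarm (m + 1) k) +
        gaussMoment a (m + 1) (fun k => k * gaussHarm a k) +
        2 * gaussMoment a (m + 1) (fun k => k * shiftHarm (m + 1) k) +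
        gaussMoment a (m + 1) (shiftHarm (m + 1)) := by
  have wg := IsWeight.gaussHarm h0 h1
  have ws := IsWeight.shiftHarm h0 h1 (m := m + 1) (by omega)
  have w := IsWeight.mul h0 h1 (m := m + 1) (by omega)
  have g1 := wg.summable_mul h0 h1 hm
  have p1 := ws.summable_mul h0 h1 hm
  have p0 := ws.summable h0 h1 (m := m + 1) (by omega)
  have h1' := w.summable_mul h0 h1 hm
  have h0' := w.summable h0 h1 (m := m + 1) (by omega)
  have t0 := wg.tendsto h0 h1 (m := m + 1) (by omega)
  have key := tsum_sub_succ_eq_zero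
    (((((h1'.mul_left ((m : ℝ) - 1)).sub (h0'.mul_left (a * (1 - a)))).sub g1).sub
      (p1.mul_left 2)).sub p0)
    -- The same correction as for `shiftHarm` alone, now weighted by `gaussHarm`.
    (y := fun k => k * (m + k) * gaussTerm a (m + 1) k * (gaussHarm a k * shiftHarm (m + 1) k) -
      k * (gaussTerm a (m + 1) k * gaussHarm a k))
    (by simp) (by simpa using (tendsto_boundary h0 h1 hm w).sub t0) fun k => by
      have : (2 : ℝ) ≤ m := by exact_mod_cast hm
      have hk : (0 : ℝ) ≤ k := k.cast_nonneg
      have hk1 : (0 : ℝ) < k + 1 - a := by linarith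
      rw [gaussTerm_succ, shiftHarm_succ, gaussHarm_succ]
      push_cast
      field_simp
      ring
  rw [((((h1'.mul_left _).sub (h0'.mul_left _)).sub g1).sub (p1.mul_left 2)).tsum_sub p0,
    (((h1'.mul_left _).sub (h0'.mul_left _)).sub g1).tsum_sub (p1.mul_left 2),
    ((h1'.mul_left _).sub (h0'.mul_left _)).tsum_sub g1,
    (h1'.mul_left _).tsum_sub (h0'.mul_left _), tsum_mul_left, tsum_mul_left, tsum_mul_left] at key
  unfold gaussMoment
  linarith

/-- Lowering the parameter multiplies the term by (m+k)/m and adds k/(m(m+k)) to `shiftHarm`; the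
product of these two is the k/m² of the last moment. -/
theorem gaussMoment_shift (h0 : 0 < a) (h1 : a < 1) (hm : 2 ≤ m) {w : ℕ → ℝ}
    (hw : IsWeight a w) (hws : IsWeight a fun k => w k * shiftHarm (m + 1) k) :
    gaussMoment a m (fun k => w k * shiftHarm m k) =
      gaussMoment a (m + 1) (fun k => w k * shiftHarm (m + 1) k) +
      gaussMoment a (m + 1) (fun k => k * (w k * shiftHarm (m + 1) k)) / m +
      gaussMoment a (m + 1) (fun k => k * w k) / m ^ 2 := by
  have hm' : (2 : ℝ) ≤ m := by exact_mod_cast hm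
  unfold gaussMoment
  have e1 := hws.summable h0 h1 (m := m + 1) (by omega)
  have e2 := (hws.summable_mul h0 h1 hm).div_const (m : ℝ)
  rw [← tsum_div_const, ← tsum_div_const, ← e1.tsum_add e2,
    ← (e1.add e2).tsum_add ((hw.summable_mul h0 h1 hm).div_const _)]
  congr 1 with k
  have hk : (0 : ℝ) ≤ k := k.cast_nonneg
  have := mul_gaussTerm_eq a (m := m) (by omega) k
  rw [eq_comm, ← eq_div_iff (by positivity)] at this
  simp only [shiftHarm_eq (m := m) (by omega), this]
  field_simp

end

/-! ### Recursions in the lower parameter -/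

section

variable {a : ℝ} {m : ℕ}

theorem gaussMoment_one_pos (h0 : 0 < a) (h1 : a < 1) (hm : 2 ≤ m) :
    0 < gaussMoment a m fun _ => 1 :=
  ((IsWeight.one h0 h1).summable h0 h1 hm).tsum_pos
    (fun k => mul_nonneg (gaussTerm_pos h0 h1 (by omega) k).le zero_le_one) 0
    (by simp [gaussTerm_zero])

/-- Contiguity leaves a first moment, which `moment_relation_one` eliminates; then m(m-1) + a(1-a) =
(m-a)(m-1+a). -/
theorem gaussMoment_one_succ (h0 : 0 < a) (h1 : a < 1) (hm : 2 ≤ m) :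
    gaussMoment a m (fun _ => 1) =
      (m - a) * (m - 1 + a) / (m * (m - 1)) * gaussMoment a (m + 1) fun _ => 1 := by
  have hm' : (2 : ℝ) ≤ m := by exact_mod_cast hm
  have hm1 : (0 : ℝ) < m - 1 := by linarith
  have r1 := moment_relation_one h0 h1 hm
  rw [gaussMoment_contiguous h0 h1 hm (IsWeight.one h0 h1)]
  rw [mul_comm, ← eq_div_iff hm1.ne'] at r1
  rw [r1]
  field_simp
  ring

/-- The recursion of `∂ log F` in the numerator parameters. -/
theorem gaussHarm_ratio_succ (h0 : 0 < a) (h1 : a < 1) (hm : 2 ≤ m) :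
    gaussMoment a m (gaussHarm a) / gaussMoment a m (fun _ => 1) =
      gaussMoment a (m + 1) (gaussHarm a) / gaussMoment a (m + 1) (fun _ => 1) +
        (2 / (m - 1) - 1 / (m - a) - 1 / (m - 1 + a)) := by
  have hm' : (2 : ℝ) ≤ m := by exact_mod_cast hm
  have hm1 : (0 : ℝ) < m - 1 := by linarith
  have hm2 : (0 : ℝ) < m - a := by linarith
  have hm3 : (0 : ℝ) < m - 1 + a := by linarith
  have r1 := moment_relation_one h0 h1 hm
  have r2 := moment_relation_gaussHarm h0 h1 hm
  have hF := gaussMoment_one_pos h0 h1 (m := m + 1) (by omega)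
  rw [gaussMoment_one_succ h0 h1 hm, gaussMoment_contiguous h0 h1 hm (IsWeight.gaussHarm h0 h1)]
  rw [mul_comm, ← eq_div_iff hm1.ne'] at r1 r2
  rw [r2, r1]
  generalize gaussMoment a (m + 1) (fun _ => 1) = F at *
  generalize gaussMoment a (m + 1) (gaussHarm a) = G at *
  field_simp
  ring

/-- The recursion of `∂ log F` in the lower parameter, compared with the preceding one. -/
theorem shiftHarm_ratio_succ (h0 : 0 < a) (h1 : a < 1) (hm : 2 ≤ m) :
    gaussMoment a m (shiftHarm m) / gaussMoment a m (fun _ => 1) =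
      gaussMoment a (m + 1) (shiftHarm (m + 1)) / gaussMoment a (m + 1) (fun _ => 1) +
        (1 / m + 1 / (m - 1) - 1 / (m - a) - 1 / (m - 1 + a)) := by
  have hm' : (2 : ℝ) ≤ m := by exact_mod_cast hm
  have hm1 : (0 : ℝ) < m - 1 := by linarith
  have hm2 : (0 : ℝ) < m - a := by linarith
  have hm3 : (0 : ℝ) < m - 1 + a := by linarith
  have r1 := moment_relation_one h0 h1 hm
  have r2 := moment_relation_shiftHarm h0 h1 hm
  have hF := gaussMoment_one_pos h0 h1 (m := m + 1) (by omega)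
  have hK := gaussMoment_shift h0 h1 hm (IsWeight.one h0 h1)
    (by simpa using IsWeight.shiftHarm h0 h1 (m := m + 1) (by omega))
  simp only [one_mul] at hK
  change gaussMoment a m (shiftHarm m) = gaussMoment a (m + 1) (shiftHarm (m + 1)) + _ + _ at hK
  rw [gaussMoment_one_succ h0 h1 hm, hK]
  rw [mul_comm, ← eq_div_iff hm1.ne'] at r1 r2
  rw [r2, r1]
  generalize gaussMoment a (m + 1) (fun _ => 1) = F at *
  generalize gaussMoment a (m + 1) (shiftHarm (m + 1)) = G at *
  field_simp
  ring

/-- The covariance of the weights `gaussHarm` and `shiftHarm`: a mixed second derivative of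
`log F`. -/
noncomputable def gaussCov (a : ℝ) (m : ℕ) : ℝ :=
  gaussMoment a m (fun k => gaussHarm a k * shiftHarm m k) / gaussMoment a m (fun _ => 1) -
    gaussMoment a m (gaussHarm a) / gaussMoment a m (fun _ => 1) *
      (gaussMoment a m (shiftHarm m) / gaussMoment a m (fun _ => 1))

/-- All moments at m reduce linearly to F, G, K, T at m+1. The increment is that of 2ψ'(m-1) -
ψ'(m-a) - ψ'(m-1+a), as Gauss's formula predicts. -/
theorem gaussCov_succ (h0 : 0 < a) (h1 : a < 1) (hm : 2 ≤ m) :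
    gaussCov a m = gaussCov a (m + 1) +
      (2 / (m - 1) ^ 2 - 1 / (m - a) ^ 2 - 1 / (m - 1 + a) ^ 2) := by
  have hm' : (2 : ℝ) ≤ m := by exact_mod_cast hm
  have hm1 : (0 : ℝ) < m - 1 := by linarith
  have hm2 : (0 : ℝ) < m - a := by linarith
  have hm3 : (0 : ℝ) < m - 1 + a := by linarith
  have r1 := moment_relation_one h0 h1 hm
  have r2 := moment_relation_gaussHarm h0 h1 hm
  have r3 := moment_relation_shiftHarm h0 h1 hm
  have r4 := moment_relation_mul h0 h1 hm
  have hF := gaussMoment_one_pos h0 h1 (m := m + 1) (by omega)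
  have hT := gaussMoment_shift h0 h1 hm (IsWeight.gaussHarm h0 h1)
    (IsWeight.mul h0 h1 (m := m + 1) (by omega))
  unfold gaussCov
  rw [shiftHarm_ratio_succ h0 h1 hm, gaussHarm_ratio_succ h0 h1 hm,
    gaussMoment_one_succ h0 h1 hm, hT]
  rw [mul_comm, ← eq_div_iff hm1.ne'] at r1 r2 r3 r4
  rw [r4, r3, r2, r1]
  generalize gaussMoment a (m + 1) (fun _ => 1) = F at *
  generalize gaussMoment a (m + 1) (gaussHarm a) = G at *
  generalize gaussMoment a (m + 1) (shiftHarm (m + 1)) = K at *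
  generalize gaussMoment a (m + 1) (fun k => gaussHarm a k * shiftHarm (m + 1) k) = T at *
  field_simp
  ring

/-! ### Summing the recursions from infinity down to m = 2 -/

theorem tendsto_gaussMoment_one (h0 : 0 < a) (h1 : a < 1) :
    Tendsto (fun m => gaussMoment a m fun _ => 1) atTop (𝓝 1) :=
  tendsto_tsum_gaussTerm h0 h1 (w := fun _ _ => 1) (fun _ _ => IsWeight.one h0 h1) fun _ => rfl

theorem tendsto_gaussHarm_ratio (h0 : 0 < a) (h1 : a < 1) :
    Tendsto (fun m => gaussMoment a m (gaussHarm a) / gaussMoment a m fun _ => 1) atTop (𝓝 0) := by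
  have := tendsto_tsum_gaussTerm h0 h1 (w := fun _ => gaussHarm a)
    (fun _ _ => IsWeight.gaussHarm h0 h1) fun _ => gaussHarm_zero a
  have l := this.div (tendsto_gaussMoment_one h0 h1) one_ne_zero
  rw [zero_div] at l
  exact l

theorem tendsto_shiftHarm_ratio (h0 : 0 < a) (h1 : a < 1) :
    Tendsto (fun m => gaussMoment a m (shiftHarm m) / gaussMoment a m fun _ => 1)
      atTop (𝓝 0) := by
  have := tendsto_tsum_gaussTerm h0 h1 (w := fun m => shiftHarm m)
    (fun _ hm => IsWeight.shiftHarm h0 h1 (by omega)) shiftHarm_zero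
  have l := this.div (tendsto_gaussMoment_one h0 h1) one_ne_zero
  rw [zero_div] at l
  exact l

theorem tendsto_gaussCov (h0 : 0 < a) (h1 : a < 1) :
    Tendsto (gaussCov a) atTop (𝓝 0) := by
  have := tendsto_tsum_gaussTerm h0 h1 (w := fun m k => gaussHarm a k * shiftHarm m k)
    (fun _ hm => IsWeight.mul h0 h1 (by omega)) (c := 0) (by simp [shiftHarm_zero])
  have l := (this.div (tendsto_gaussMoment_one h0 h1) one_ne_zero).sub
    ((tendsto_gaussHarm_ratio h0 h1).mul (tendsto_shiftHarm_ratio h0 h1))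
  rw [zero_div, mul_zero, sub_zero] at l
  exact l

theorem eq_of_telescoping {u c : ℕ → ℝ} {l : ℝ} (hu : Tendsto u atTop (𝓝 0))
    (h : ∀ n, u n = u (n + 1) + c n) (hc : Tendsto (fun N => ∑ n ∈ range N, c n) atTop (𝓝 l)) :
    u 0 = l := by
  have e : ∀ N, ∑ n ∈ range N, c n = u 0 - u N := fun N => by
    rw [← sum_range_sub']
    exact sum_congr rfl fun n _ => by rw [h n]; ring
  simp only [e] at hc
  exact tendsto_nhds_unique (by simpa using hu.const_sub (u 0)) hc

theorem tendsto_harmonic_tail : Tendsto (fun N : ℕ => 1 / ((N : ℝ) + 1)) atTop (𝓝 0) :=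
  tendsto_one_div_add_atTop_nhds_zero_nat

theorem gaussHarm_ratio_two (h0 : 0 < a) (h1 : a < 1) {l : ℝ}
    (hl : Tendsto (fun N => gaussHarm a N - 2 * (harmonic N : ℝ)) atTop (𝓝 l)) :
    gaussMoment a 2 (gaussHarm a) / gaussMoment a 2 (fun _ => 1) = 1 / (a * (1 - a)) - l := by
  have h2 : 0 < 1 - a := by linarith
  refine eq_of_telescoping
    (u := fun n => gaussMoment a (n + 2) (gaussHarm a) / gaussMoment a (n + 2) fun _ => 1)
    (c := fun n => 2 / ((n : ℝ) + 1) - 1 / (n + 2 - a) - 1 / (n + 1 + a))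
    ((tendsto_gaussHarm_ratio h0 h1).comp (tendsto_add_atTop_nat 2)) (fun n => ?_) ?_
  · rw [gaussHarm_ratio_succ h0 h1 (by omega)]
    push_cast
    ring
  -- The recursion starts at m = 2, so the j = 0 terms 1/a + 1/(1-a) = 1/(a(1-a)) of `gaussHarm` are
  -- missing and are added back.
  · have e : ∀ N : ℕ, ∑ n ∈ range N, (2 / ((n : ℝ) + 1) - 1 / (n + 2 - a) - 1 / (n + 1 + a)) =
        1 / (a * (1 - a)) - (gaussHarm a (N + 1) - 2 * (harmonic (N + 1) : ℝ))
          - 2 * (1 / ((N : ℝ) + 1)) := fun N => by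
      induction N with
      | zero => simp [gaussHarm, harmonic]; field_simp; ring
      | succ N ih =>
        rw [sum_range_succ, ih, gaussHarm_succ a (N + 1), harmonic_cast_succ (N + 1)]
        push_cast
        ring
    simp only [e]
    simpa using ((hl.comp (tendsto_add_atTop_nat 1)).const_sub (1 / (a * (1 - a)))).sub
      (tendsto_harmonic_tail.const_mul 2)

/-- The two recursions differ by 1/m - 1/(m-1), which is free of a and sums to -1. -/
theorem shiftHarm_ratio_two (h0 : 0 < a) (h1 : a < 1) :
    gaussMoment a 2 (shiftHarm 2) / gaussMoment a 2 (fun _ => 1) =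
      gaussMoment a 2 (gaussHarm a) / gaussMoment a 2 (fun _ => 1) - 1 := by
  have l0 := ((tendsto_shiftHarm_ratio h0 h1).comp (tendsto_add_atTop_nat 2)).sub
    ((tendsto_gaussHarm_ratio h0 h1).comp (tendsto_add_atTop_nat 2))
  rw [sub_zero] at l0
  have := eq_of_telescoping (l := -1)
    (u := fun n => gaussMoment a (n + 2) (shiftHarm (n + 2)) / gaussMoment a (n + 2) (fun _ => 1) -
      gaussMoment a (n + 2) (gaussHarm a) / gaussMoment a (n + 2) fun _ => 1)
    (c := fun n => 1 / ((n : ℝ) + 2) - 1 / (n + 1))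
    l0 (fun n => ?_) ?_
  · linarith
  · rw [gaussHarm_ratio_succ h0 h1 (by omega), shiftHarm_ratio_succ h0 h1 (by omega)]
    push_cast
    ring
  · have e : ∀ N : ℕ, ∑ n ∈ range N, (1 / ((n : ℝ) + 2) - 1 / (n + 1)) =
        1 / ((N : ℝ) + 1) - 1 := fun N => by
      induction N with
      | zero => simp
      | succ N ih =>
        rw [sum_range_succ, ih]
        push_cast
        ring
    simp only [e]
    simpa using tendsto_harmonic_tail.sub_const 1

theorem gaussCov_two (h0 : 0 < a) (h1 : a < 1) {z : ℝ}
    (hz : Tendsto (fun N => ∑ j ∈ range N, (1 / ((j : ℝ) + a) ^ 2 + 1 / ((j : ℝ) + 1 - a) ^ 2))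
      atTop (𝓝 z)) :
    gaussCov a 2 = π ^ 2 / 3 + 1 / a ^ 2 + 1 / (1 - a) ^ 2 - z := by
  refine eq_of_telescoping (u := fun n => gaussCov a (n + 2))
    (c := fun n => 2 / ((n : ℝ) + 1) ^ 2 - 1 / (n + 2 - a) ^ 2 - 1 / (n + 1 + a) ^ 2)
    ((tendsto_gaussCov h0 h1).comp (tendsto_add_atTop_nat 2)) (fun n => ?_) ?_
  · rw [gaussCov_succ h0 h1 (by omega)]
    push_cast
    ring
  -- The sum of 1/n² includes n = 0, where division by zero gives 0; this matches the form of
  -- `hasSum_zeta_two`.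
  · have e : ∀ N : ℕ, ∑ n ∈ range N,
        (2 / ((n : ℝ) + 1) ^ 2 - 1 / (n + 2 - a) ^ 2 - 1 / (n + 1 + a) ^ 2) =
        2 * (∑ n ∈ range (N + 1), 1 / (n : ℝ) ^ 2) + 1 / a ^ 2 + 1 / (1 - a) ^ 2 -
          ∑ j ∈ range (N + 1), (1 / ((j : ℝ) + a) ^ 2 + 1 / ((j : ℝ) + 1 - a) ^ 2) := fun N => by
      induction N with
      | zero => simp
      | succ N ih =>
        rw [sum_range_succ, ih, sum_range_succ _ (N + 1), sum_range_succ _ (N + 1)]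
        push_cast
        ring
    simp only [e]
    have hz2 := (hasSum_zeta_two.tendsto_sum_nat.comp (tendsto_add_atTop_nat 1)).const_mul 2
    have := ((hz2.add_const (1 / a ^ 2)).add_const (1 / (1 - a) ^ 2)).sub
      (hz.comp (tendsto_add_atTop_nat 1))
    rw [show 2 * (π ^ 2 / 6) = π ^ 2 / 3 by ring] at this
    exact this

/-- Gauss's evaluation of `₂F₁(a, 1 - a; 2; 1)`. -/
theorem gaussMoment_two_one (h0 : 0 < a) (h1 : a < 1) :
    gaussMoment a 2 (fun _ => 1) = sin (π * a) / (π * (a * (1 - a))) := by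
  have h2 : 0 < 1 - a := by linarith
  -- Each recursion factor is Euler's (n+1-a)(n+1+a)/(n+1)² times a quotient that telescopes to the
  -- middle factor.
  have e : ∀ N : ℕ, gaussMoment a 2 (fun _ => 1) =
      (∏ j ∈ range N, (1 - a ^ 2 / ((j : ℝ) + 1) ^ 2)) * ((N + 1 - a) / (N + 1) / (1 - a)) *
        gaussMoment a (N + 2) fun _ => 1 := fun N => by
    induction N with
    | zero => simp; field_simp
    | succ N ih =>
      rw [ih, gaussMoment_one_succ h0 h1 (by omega), prod_range_succ]
      have hN : (0 : ℝ) ≤ N := N.cast_nonneg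
      have hN1 : (0 : ℝ) < N + 1 - a := by linarith
      push_cast
      have e1 : (N : ℝ) + 2 - 1 = N + 1 := by ring
      rw [e1]
      field_simp
      ring
  have l1 := (Real.tendsto_euler_sin_prod a).const_mul (1 / (π * a))
  have l2 : Tendsto (fun N : ℕ => ((N : ℝ) + 1 - a) / (N + 1) / (1 - a)) atTop
      (𝓝 (1 / (1 - a))) := by
    have := ((tendsto_harmonic_tail.const_mul a).const_sub 1).div_const (1 - a)
    rw [mul_zero, sub_zero] at this
    refine this.congr fun N => ?_
    have : (0 : ℝ) < N + 1 := by positivity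
    field_simp
  have l3 := (tendsto_gaussMoment_one h0 h1).comp (tendsto_add_atTop_nat 2)
  have l := (l1.mul l2).mul l3
  refine tendsto_nhds_unique (f := fun _ : ℕ => _) (l := atTop) tendsto_const_nhds ?_
  refine (l.congr' (f₂ := fun _ => gaussMoment a 2 fun _ => 1) (.of_forall fun N => ?_)).trans ?_
  · dsimp only [Function.comp]
    have hpi := pi_pos
    rw [e N]
    field_simp
  · apply le_of_eq
    congr 1
    field_simp

/-- With means G and G - 1 at m = 2, the mean of the product plus G equals Cov + G(G-1) + G = Cov +
G². -/
theorem hasSum_gauss_harmonic (h0 : 0 < a) (h1 : a < 1) {l z : ℝ}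
    (hl : Tendsto (fun N => gaussHarm a N - 2 * (harmonic N : ℝ)) atTop (𝓝 l))
    (hz : Tendsto (fun N => ∑ j ∈ range N, (1 / ((j : ℝ) + a) ^ 2 + 1 / ((j : ℝ) + 1 - a) ^ 2))
      atTop (𝓝 z)) :
    HasSum (fun k : ℕ => gaussTerm a 1 k * (gaussHarm a k * harmonic (k + 1) / ((k : ℝ) + 1)))
      (sin (π * a) / (π * (a * (1 - a))) * ((1 / (a * (1 - a)) - l) ^ 2 +
        (π ^ 2 / 3 + 1 / a ^ 2 + 1 / (1 - a) ^ 2 - z))) := by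
  have sT := (IsWeight.mul h0 h1 one_le_two).summable h0 h1 le_rfl
  have sG := (IsWeight.gaussHarm h0 h1).summable h0 h1 le_rfl
  have hF := gaussMoment_one_pos h0 h1 le_rfl
  convert! sT.hasSum.add sG.hasSum using 1
  · ext k
    rw [gaussTerm_two_eq, shiftHarm_two]
    ring
  · change _ = gaussMoment a 2 (fun k => gaussHarm a k * shiftHarm 2 k) +
      gaussMoment a 2 (gaussHarm a)
    have c := gaussCov_two h0 h1 hz
    rw [← c, ← gaussHarm_ratio_two h0 h1 hl, ← gaussMoment_two_one h0 h1, gaussCov,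
      shiftHarm_ratio_two h0 h1]
    field_simp
    ring

end

/-! ### Integration against the logarithm -/

/-- A primitive of `-t ^ k * log (1 - t)`. -/
noncomputable def powMulLogPrimitive (k : ℕ) (t : ℝ) : ℝ :=
  ((1 - t ^ (k + 1)) * log (1 - t) + ∑ j ∈ range (k + 1), t ^ (j + 1) / ((j : ℝ) + 1)) / (k + 1)

/-- The factor 1 - t^(k+1) contains 1 - t, and x log x is continuous at 0, so the singularity at t =
1 disappears. -/
theorem continuous_powMulLogPrimitive (k : ℕ) : Continuous (powMulLogPrimitive k) := by
  have e : powMulLogPrimitive k = fun t : ℝ => ((∑ j ∈ range (k + 1), t ^ j) *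
      ((1 - t) * log (1 - t)) + ∑ j ∈ range (k + 1), t ^ (j + 1) / ((j : ℝ) + 1)) / (k + 1) := by
    ext t
    rw [← mul_assoc, geom_sum_mul_neg]
    rfl
  rw [e]
  have := continuous_mul_log.comp (continuous_const.sub continuous_id : Continuous fun t : ℝ => 1 - t)
  exact (((by fun_prop : Continuous fun t : ℝ => ∑ j ∈ range (k + 1), t ^ j).mul this).add
    (by fun_prop)).div_const _

theorem hasDerivAt_powMulLogPrimitive (k : ℕ) {t : ℝ} (ht : t < 1) :
    HasDerivAt (powMulLogPrimitive k) (-(t ^ k * log (1 - t))) t := by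
  have h1 : 1 - t ≠ 0 := by linarith
  have d1 : HasDerivAt (fun t : ℝ => 1 - t ^ (k + 1)) (-((k + 1 : ℕ) * t ^ k)) t := by
    simpa using (hasDerivAt_pow (k + 1) t).const_sub 1
  have d2 : HasDerivAt (fun t : ℝ => log (1 - t)) (-1 / (1 - t)) t :=
    ((hasDerivAt_id t).const_sub 1).log h1
  have d3 : HasDerivAt (fun t : ℝ => ∑ j ∈ range (k + 1), t ^ (j + 1) / ((j : ℝ) + 1))
      (∑ j ∈ range (k + 1), t ^ j) t := by
    refine HasDerivAt.fun_sum fun j _ => ?_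
    have := (hasDerivAt_pow (j + 1) t).div_const ((j : ℝ) + 1)
    have hj : (j : ℝ) + 1 ≠ 0 := by positivity
    convert! this using 1
    rw [Nat.add_sub_cancel]
    push_cast
    field_simp
  have hk : (k : ℝ) + 1 ≠ 0 := by positivity
  convert! ((d1.mul d2).add d3).div_const ((k : ℝ) + 1) using 1
  rw [← geom_sum_mul_neg]
  push_cast
  field_simp
  ring

theorem powMulLogPrimitive_zero (k : ℕ) : powMulLogPrimitive k 0 = 0 := by
  simp [powMulLogPrimitive]

theorem powMulLogPrimitive_one (k : ℕ) :
    powMulLogPrimitive k 1 = harmonic (k + 1) / ((k : ℝ) + 1) := by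
  simp [powMulLogPrimitive, harmonic_cast_eq_sum, sum_range_succ]

theorem intervalIntegrable_pow_mul_log (k : ℕ) :
    IntervalIntegrable (fun t : ℝ => -(t ^ k * log (1 - t))) volume 0 1 := by
  rw [intervalIntegrable_iff_integrableOn_Ioc_of_le zero_le_one]
  refine intervalIntegral.integrableOn_deriv_of_nonneg
    (continuous_powMulLogPrimitive k).continuousOn
    (fun t ht => hasDerivAt_powMulLogPrimitive k ht.2) fun t ht => ?_
  rw [← mul_neg]
  exact mul_nonneg (pow_nonneg ht.1.le _)
    (neg_nonneg.2 (log_nonpos (by linarith [ht.2]) (by linarith [ht.1])))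

theorem integral_pow_mul_log (k : ℕ) :
    ∫ t in (0 : ℝ)..1, -(t ^ k * log (1 - t)) = harmonic (k + 1) / ((k : ℝ) + 1) := by
  rw [intervalIntegral.integral_eq_sub_of_hasDerivAt_of_le zero_le_one
    (continuous_powMulLogPrimitive k).continuousOn
    (fun t ht => hasDerivAt_powMulLogPrimitive k ht.2) (intervalIntegrable_pow_mul_log k),
    powMulLogPrimitive_zero, powMulLogPrimitive_one, sub_zero]

/-- Termwise integration of a power series with nonnegative coefficients against `-log (1 - t)`. -/
theorem integral_powerSeries_mul_log {c : ℕ → ℝ} (hc : ∀ k, 0 ≤ c k)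
    (hs : Summable fun k : ℕ => c k * (harmonic (k + 1) / ((k : ℝ) + 1))) {n : ℕ} (hn : 0 < c n) :
    IntervalIntegrable (fun t : ℝ => (∑' k, c k * t ^ k) * log (1 - t)) volume 0 1 ∧
    -(∫ t in (0 : ℝ)..1, (∑' k, c k * t ^ k) * log (1 - t)) =
      ∑' k : ℕ, c k * (harmonic (k + 1) / ((k : ℝ) + 1)) := by
  set μ : Measure ℝ := volume.restrict (Set.Ioc 0 1) with hμ
  set F : ℕ → ℝ → ℝ := fun k t => c k * -(t ^ k * log (1 - t)) with hF
  have hpos : ∀ k, ∀ t ∈ Set.Ioc (0 : ℝ) 1, 0 ≤ F k t := fun k t ht => by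
    rw [hF]
    dsimp only
    rw [← mul_neg]
    refine mul_nonneg (hc k) (mul_nonneg (pow_nonneg ht.1.le _) (neg_nonneg.2 ?_))
    exact log_nonpos (by linarith [ht.2]) (by linarith [ht.1])
  have hint : ∀ k, Integrable (F k) μ := fun k =>
    ((intervalIntegrable_iff_integrableOn_Ioc_of_le zero_le_one).1
      (intervalIntegrable_pow_mul_log k)).const_mul (c k)
  have hval : ∀ k, ∫ t, F k t ∂μ = c k * (harmonic (k + 1) / ((k : ℝ) + 1)) := fun k => by
    rw [hF, hμ, integral_const_mul, ← integral_pow_mul_log,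
      intervalIntegral.integral_of_le zero_le_one]
  have hnorm : ∀ k, ∫ t, ‖F k t‖ ∂μ = c k * (harmonic (k + 1) / ((k : ℝ) + 1)) := fun k => by
    rw [← hval]
    exact setIntegral_congr_fun measurableSet_Ioc fun t ht => Real.norm_of_nonneg (hpos k t ht)
  have key := hasSum_integral_of_summable_integral_norm hint (by simpa only [hnorm] using hs)
  simp only [hval] at key
  have hH : ∀ k : ℕ, 0 < (harmonic (k + 1) : ℝ) / ((k : ℝ) + 1) := fun k => by
    have : (0 : ℝ) < harmonic (k + 1) := by exact_mod_cast harmonic_pos (by omega)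
    positivity
  -- A nonzero Bochner integral forces integrability, since a non-integrable function has integral
  -- 0. This is the use of the positive coefficient `c n`.
  have hne : ∫ t, ∑' k, F k t ∂μ ≠ 0 := by
    rw [← key.tsum_eq]
    exact (hs.tsum_pos (fun k => mul_nonneg (hc k) (hH k).le) n (mul_pos hn (hH n))).ne'
  have hFe : (fun t => ∑' k, F k t) = fun t => -((∑' k, c k * t ^ k) * log (1 - t)) := by
    ext t
    rw [← mul_neg, ← tsum_mul_right]
    exact tsum_congr fun k => by rw [hF]; ring
  have hI : Integrable (fun t => ∑' k, F k t) μ := Integrable.of_integral_ne_zero hne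
  rw [hFe] at hI key
  constructor
  · rw [intervalIntegrable_iff_integrableOn_Ioc_of_le zero_le_one]
    exact integrable_neg_iff.1 hI
  · rw [intervalIntegral.integral_of_le zero_le_one, key.tsum_eq, integral_neg]

/-! ### The evaluation for a general degree -/

section

variable {a : ℝ}

theorem gaussTerm_mul_gaussHarm_le (h0 : 0 < a) (h1 : a < 1) (k : ℕ) :
    gaussTerm a 1 k * gaussHarm a k ≤ 1 / (a * (1 - a)) := by
  have h2 : 0 < 1 - a := by linarith
  have hH : (harmonic k : ℝ) ≤ k + 1 := by
    rw [harmonic_cast_eq_sum]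
    calc _ ≤ ∑ j ∈ range k, (1 : ℝ) := sum_le_sum fun j _ =>
          div_le_one_of_le₀ (by linarith [(Nat.cast_nonneg j : (0 : ℝ) ≤ j)]) (by positivity)
      _ ≤ _ := by simp
  calc _ ≤ 1 / ((k : ℝ) + 1) * (1 / (a * (1 - a)) * (k + 1)) := by
        refine mul_le_mul (gaussTerm_one_le h0 h1 k) ?_ (gaussHarm_nonneg h0 h1 k) (by positivity)
        exact (gaussHarm_le_harmonic h0 h1 k).trans (by gcongr)
    _ = _ := by field_simp

theorem summable_gauss_powerSeries (h0 : 0 < a) (h1 : a < 1) {t : ℝ} (ht : t ∈ Set.Ico (0 : ℝ) 1) :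
    Summable fun k => gaussTerm a 1 k * gaussHarm a k * t ^ k := by
  refine Summable.of_nonneg_of_le (fun k => ?_) (fun k => ?_)
    ((summable_geometric_of_lt_one ht.1 ht.2).mul_left (1 / (a * (1 - a))))
  · exact mul_nonneg (mul_nonneg (gaussTerm_pos h0 h1 le_rfl k).le (gaussHarm_nonneg h0 h1 k))
      (pow_nonneg ht.1 k)
  · exact mul_le_mul_of_nonneg_right (gaussTerm_mul_gaussHarm_le h0 h1 k) (pow_nonneg ht.1 k)

/-- The evaluation for an arbitrary degree `-a`, given the two constants attached to `a`. `S` is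
the Legendre–Sun series and `s` its harmonic modulation, up to a common factor `r`. -/
theorem legendreSun_evaluation (h0 : 0 < a) (h1 : a < 1) {l z r : ℝ} (hr : r ≠ 0)
    (hl : Tendsto (fun N => gaussHarm a N - 2 * (harmonic N : ℝ)) atTop (𝓝 l))
    (hz : Tendsto (fun N => ∑ j ∈ range N, (1 / ((j : ℝ) + a) ^ 2 + 1 / ((j : ℝ) + 1 - a) ^ 2))
      atTop (𝓝 z)) {T : ℝ → ℕ → ℝ} {s : ℕ → ℝ}
    (hT : ∀ t k, r * T t k = gaussTerm a 1 k * gaussHarm a k * t ^ k)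
    (hs : ∀ k, r * s k =
      gaussTerm a 1 k * (gaussHarm a k * harmonic (k + 1) / ((k : ℝ) + 1))) :
    (∀ t ∈ Set.Ico (0 : ℝ) 1, Summable fun k : ℕ => T t (k + 1)) ∧
      IntervalIntegrable (fun t : ℝ => (r * ∑' k : ℕ, T t (k + 1)) * log (1 - t)) volume 0 1 ∧
      Summable s ∧
      -(∫ t in (0 : ℝ)..1, (r * ∑' k : ℕ, T t (k + 1)) * log (1 - t)) = r * ∑' k : ℕ, s k ∧
      r * ∑' k : ℕ, s k =
        sin (π * a) / (π * (a * (1 - a))) * ((1 / (a * (1 - a)) - l) ^ 2 +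
          (π ^ 2 / 3 + 1 / a ^ 2 + 1 / (1 - a) ^ 2 - z)) := by
  have main := hasSum_gauss_harmonic h0 h1 hl hz
  simp only [← hs] at main
  have hsum : Summable s := (summable_mul_left_iff hr).1 main.summable
  have hSe : ∀ t, r * ∑' k : ℕ, T t (k + 1) = ∑' k, gaussTerm a 1 k * gaussHarm a k * t ^ k := by
    intro t
    -- `gaussHarm a 0 = 0`, so starting the summation at k = 1 loses nothing.
    have hT0 : T t 0 = 0 := by
      have := hT t 0
      rw [gaussHarm_zero, mul_zero, zero_mul] at this
      exact (mul_eq_zero.1 this).resolve_left hr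
    have hsupp : Function.support (T t) ⊆ Set.range Nat.succ := by
      intro k hk
      rw [Nat.range_succ]
      exact Nat.pos_of_ne_zero fun h => hk (by rw [h, hT0])
    have := Nat.succ_injective.tsum_eq hsupp
    simp only [Nat.succ_eq_add_one] at this
    rw [this, ← tsum_mul_left]
    exact tsum_congr fun k => hT t k
  have hn : 0 < gaussTerm a 1 1 * gaussHarm a 1 := by
    refine mul_pos (gaussTerm_pos h0 h1 le_rfl 1) ?_
    have h2 : 0 < 1 - a := by linarith
    simp [gaussHarm]
    positivity
  have e : ∀ k : ℕ, gaussTerm a 1 k * gaussHarm a k * (harmonic (k + 1) / ((k : ℝ) + 1)) =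
      r * s k := fun k => by rw [hs]; ring
  have hi := integral_powerSeries_mul_log (c := fun k => gaussTerm a 1 k * gaussHarm a k)
    (fun k => mul_nonneg (gaussTerm_pos h0 h1 le_rfl k).le (gaussHarm_nonneg h0 h1 k))
    (by simpa only [e] using main.summable) hn
  simp only [e, tsum_mul_left] at hi
  simp only [hSe]
  refine ⟨fun t ht => ?_, hi.1, hsum, hi.2, ?_⟩
  · have := summable_gauss_powerSeries h0 h1 ht
    simp only [← hT] at this
    exact (summable_nat_add_iff 1).2 ((summable_mul_left_iff hr).1 this)
  · rw [← tsum_mul_left, main.tsum_eq]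

end

/-! ### Harmonic sums along multiples and residue classes -/

/-- Both H_{dN} - log(dN) and H_N - log N tend to Euler's constant. -/
theorem tendsto_harmonic_mul_sub {d : ℕ} (hd : 0 < d) :
    Tendsto (fun N : ℕ => (harmonic (d * N) : ℝ) - harmonic N) atTop (𝓝 (log d)) := by
  have h1 := Real.tendsto_harmonic_sub_log
  have h2 := h1.comp (tendsto_id.const_mul_atTop' hd)
  have := (h2.sub h1).add_const (log d)
  rw [sub_self, zero_add] at this
  refine this.congr' ?_
  filter_upwards [eventually_gt_atTop 0] with N hN
  have hd' : (d : ℝ) ≠ 0 := by positivity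
  have hN' : (N : ℝ) ≠ 0 := by positivity
  simp only [Function.comp, id]
  push_cast
  rw [log_mul hd' hN']
  ring

/-- The generalized harmonic number of order two. -/
noncomputable def harmonicSq (n : ℕ) : ℝ := ∑ j ∈ range n, 1 / ((j : ℝ) + 1) ^ 2

theorem harmonicSq_zero : harmonicSq 0 = 0 := by simp [harmonicSq]

theorem harmonicSq_succ (n : ℕ) : harmonicSq (n + 1) = harmonicSq n + 1 / ((n : ℝ) + 1) ^ 2 :=
  sum_range_succ _ _

theorem tendsto_harmonicSq : Tendsto harmonicSq atTop (𝓝 (π ^ 2 / 6)) := by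
  have := ((hasSum_nat_add_iff' 1).2 hasSum_zeta_two).tendsto_sum_nat
  unfold harmonicSq
  simpa using this

theorem tendsto_harmonicSq_mul {d : ℕ} (hd : 0 < d) :
    Tendsto (fun N => harmonicSq (d * N)) atTop (𝓝 (π ^ 2 / 6)) :=
  tendsto_harmonicSq.comp (tendsto_id.const_mul_atTop' hd)

theorem gaussHarm_half (k : ℕ) :
    gaussHarm (1 / 2) k = 2 * (2 * (harmonic (2 * k) : ℝ) - harmonic k) := by
  induction k with
  | zero => simp [gaussHarm_zero]
  | succ k ih =>
    rw [gaussHarm_succ, ih, show 2 * (k + 1) = 2 * k + 1 + 1 by ring]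
    simp only [harmonic_cast_succ]
    push_cast
    have : (k : ℝ) + 1 - 1 / 2 = k + 1 / 2 := by ring
    rw [this]
    field_simp
    ring

theorem gaussHarm_third (k : ℕ) :
    gaussHarm (1 / 3) k = 3 * (harmonic (3 * k) : ℝ) - harmonic k := by
  induction k with
  | zero => simp [gaussHarm_zero]
  | succ k ih =>
    rw [gaussHarm_succ, ih, show 3 * (k + 1) = 3 * k + 1 + 1 + 1 by ring]
    simp only [harmonic_cast_succ]
    push_cast
    have : (k : ℝ) + 1 - 1 / 3 = k + 2 / 3 := by ring
    rw [this]
    field_simp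
    ring

theorem gaussHarm_quarter (k : ℕ) :
    gaussHarm (1 / 4) k = 2 * (2 * (harmonic (4 * k) : ℝ) - harmonic (2 * k)) := by
  induction k with
  | zero => simp [gaussHarm_zero]
  | succ k ih =>
    rw [gaussHarm_succ, ih, show 4 * (k + 1) = 4 * k + 1 + 1 + 1 + 1 by ring,
      show 2 * (k + 1) = 2 * k + 1 + 1 by ring]
    simp only [harmonic_cast_succ]
    push_cast
    have e1 : 1 / ((k : ℝ) + 1 / 4) = 4 * (1 / (4 * k + 1)) := by field_simp
    have e3 : 1 / ((k : ℝ) + 1 - 1 / 4) = 4 * (1 / (4 * k + 2 + 1)) := by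
      rw [show (k : ℝ) + 1 - 1 / 4 = (4 * k + 2 + 1) / 4 by ring]; field_simp
    have e2 : 1 / (4 * (k : ℝ) + 1 + 1) = 1 / 2 * (1 / (2 * k + 1)) := by field_simp; ring
    have e4 : 1 / (4 * (k : ℝ) + 3 + 1) = 1 / 2 * (1 / (2 * k + 1 + 1)) := by
      field_simp; ring
    rw [e1, e2, e3, e4]
    ring

/-- Inclusion–exclusion: up to the factor 6 the left side sums 1/n over n ≤ 6k coprime to 6. The
other degrees are the analogous sums for 2 (taken twice), 3 and 4. -/
theorem gaussHarm_sixth (k : ℕ) :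
    gaussHarm (1 / 6) k = 6 * (harmonic (6 * k) : ℝ) - 3 * harmonic (3 * k)
      - 2 * harmonic (2 * k) + harmonic k := by
  induction k with
  | zero => simp [gaussHarm_zero]
  | succ k ih =>
    rw [gaussHarm_succ, ih, show 6 * (k + 1) = 6 * k + 1 + 1 + 1 + 1 + 1 + 1 by ring,
      show 3 * (k + 1) = 3 * k + 1 + 1 + 1 by ring, show 2 * (k + 1) = 2 * k + 1 + 1 by ring]
    simp only [harmonic_cast_succ]
    push_cast
    have e1 : 1 / ((k : ℝ) + 1 / 6) = 6 * (1 / (6 * k + 1)) := by field_simp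
    have e5 : 1 / ((k : ℝ) + 1 - 1 / 6) = 6 * (1 / (6 * k + 4 + 1)) := by
      rw [show (k : ℝ) + 1 - 1 / 6 = (6 * k + 4 + 1) / 6 by ring]; field_simp
    have e2 : 1 / (6 * (k : ℝ) + 1 + 1) = 1 / 2 * (1 / (3 * k + 1)) := by field_simp; ring
    have e4 : 1 / (6 * (k : ℝ) + 3 + 1) = 1 / 2 * (1 / (3 * k + 1 + 1)) := by
      field_simp; ring
    have e6 : 1 / (6 * (k : ℝ) + 5 + 1) = 1 / 6 * (1 / (k + 1)) := by
      field_simp; ring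
    have e3 : 1 / (6 * (k : ℝ) + 2 + 1) = 1 / 3 * (1 / (2 * k + 1)) := by field_simp; ring
    have f3 : 1 / (3 * (k : ℝ) + 2 + 1) = 1 / 3 * (1 / (k + 1)) := by field_simp; ring
    have f2 : 1 / (2 * (k : ℝ) + 1 + 1) = 1 / 2 * (1 / (k + 1)) := by field_simp; ring
    rw [e1, e2, e3, e4, e5, e6, f3, f2]
    ring

theorem sum_sq_half (N : ℕ) :
    ∑ j ∈ range N, (1 / ((j : ℝ) + 1 / 2) ^ 2 + 1 / ((j : ℝ) + 1 - 1 / 2) ^ 2) =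
      8 * harmonicSq (2 * N) - 2 * harmonicSq N := by
  induction N with
  | zero => simp [harmonicSq_zero]
  | succ k ih =>
    rw [sum_range_succ, ih, show 2 * (k + 1) = 2 * k + 1 + 1 by ring]
    simp only [harmonicSq_succ]
    push_cast
    have : (k : ℝ) + 1 - 1 / 2 = k + 1 / 2 := by ring
    rw [this]
    field_simp
    ring

theorem sum_sq_third (N : ℕ) :
    ∑ j ∈ range N, (1 / ((j : ℝ) + 1 / 3) ^ 2 + 1 / ((j : ℝ) + 1 - 1 / 3) ^ 2) =
      9 * harmonicSq (3 * N) - harmonicSq N := by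
  induction N with
  | zero => simp [harmonicSq_zero]
  | succ k ih =>
    rw [sum_range_succ, ih, show 3 * (k + 1) = 3 * k + 1 + 1 + 1 by ring]
    simp only [harmonicSq_succ]
    push_cast
    have : (k : ℝ) + 1 - 1 / 3 = k + 2 / 3 := by ring
    rw [this]
    field_simp
    ring

theorem sum_sq_quarter (N : ℕ) :
    ∑ j ∈ range N, (1 / ((j : ℝ) + 1 / 4) ^ 2 + 1 / ((j : ℝ) + 1 - 1 / 4) ^ 2) =
      16 * harmonicSq (4 * N) - 4 * harmonicSq (2 * N) := by
  induction N with
  | zero => simp [harmonicSq_zero]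
  | succ k ih =>
    rw [sum_range_succ, ih, show 4 * (k + 1) = 4 * k + 1 + 1 + 1 + 1 by ring,
      show 2 * (k + 1) = 2 * k + 1 + 1 by ring]
    simp only [harmonicSq_succ]
    push_cast
    have e1 : 1 / ((k : ℝ) + 1 / 4) ^ 2 = 16 * (1 / (4 * k + 1) ^ 2) := by field_simp; norm_num
    have e3 : 1 / ((k : ℝ) + 1 - 1 / 4) ^ 2 = 16 * (1 / (4 * k + 2 + 1) ^ 2) := by
      rw [show (k : ℝ) + 1 - 1 / 4 = (4 * k + 2 + 1) / 4 by ring]; field_simp; norm_num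
    have e2 : 1 / (4 * (k : ℝ) + 1 + 1) ^ 2 = 1 / 4 * (1 / (2 * k + 1) ^ 2) := by
      field_simp; ring
    have e4 : 1 / (4 * (k : ℝ) + 3 + 1) ^ 2 = 1 / 4 * (1 / (2 * k + 1 + 1) ^ 2) := by
      field_simp; ring
    rw [e1, e2, e3, e4]
    ring

theorem sum_sq_sixth (N : ℕ) :
    ∑ j ∈ range N, (1 / ((j : ℝ) + 1 / 6) ^ 2 + 1 / ((j : ℝ) + 1 - 1 / 6) ^ 2) =
      36 * harmonicSq (6 * N) - 9 * harmonicSq (3 * N) - 4 * harmonicSq (2 * N)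
        + harmonicSq N := by
  induction N with
  | zero => simp [harmonicSq_zero]
  | succ k ih =>
    rw [sum_range_succ, ih, show 6 * (k + 1) = 6 * k + 1 + 1 + 1 + 1 + 1 + 1 by ring,
      show 3 * (k + 1) = 3 * k + 1 + 1 + 1 by ring, show 2 * (k + 1) = 2 * k + 1 + 1 by ring]
    simp only [harmonicSq_succ]
    push_cast
    have e1 : 1 / ((k : ℝ) + 1 / 6) ^ 2 = 36 * (1 / (6 * k + 1) ^ 2) := by field_simp; norm_num
    have e5 : 1 / ((k : ℝ) + 1 - 1 / 6) ^ 2 = 36 * (1 / (6 * k + 4 + 1) ^ 2) := by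
      rw [show (k : ℝ) + 1 - 1 / 6 = (6 * k + 4 + 1) / 6 by ring]
      field_simp; norm_num
    have e2 : 1 / (6 * (k : ℝ) + 1 + 1) ^ 2 = 1 / 4 * (1 / (3 * k + 1) ^ 2) := by
      field_simp; ring
    have e4 : 1 / (6 * (k : ℝ) + 3 + 1) ^ 2 = 1 / 4 * (1 / (3 * k + 1 + 1) ^ 2) := by
      field_simp; ring
    have e6 : 1 / (6 * (k : ℝ) + 5 + 1) ^ 2 = 1 / 36 * (1 / (k + 1) ^ 2) := by
      field_simp; ring
    have e3 : 1 / (6 * (k : ℝ) + 2 + 1) ^ 2 = 1 / 9 * (1 / (2 * k + 1) ^ 2) := by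
      field_simp; ring
    have f3 : 1 / (3 * (k : ℝ) + 2 + 1) ^ 2 = 1 / 9 * (1 / (k + 1) ^ 2) := by
      field_simp; ring
    have f2 : 1 / (2 * (k : ℝ) + 1 + 1) ^ 2 = 1 / 4 * (1 / (k + 1) ^ 2) := by field_simp; ring
    rw [e1, e2, e3, e4, e5, e6, f3, f2]
    ring

/-! ### Binomial products as hypergeometric terms -/

theorem cast_choose_two_mul (k : ℕ) :
    ((2 * k).choose k : ℝ) = (2 * k).factorial / (k.factorial * k.factorial) := by
  rw [Nat.cast_choose ℝ (by omega : k ≤ 2 * k), show 2 * k - k = k by omega]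

theorem cast_choose_three_mul (k : ℕ) :
    ((3 * k).choose k : ℝ) = (3 * k).factorial / (k.factorial * (2 * k).factorial) := by
  rw [Nat.cast_choose ℝ (by omega : k ≤ 3 * k), show 3 * k - k = 2 * k by omega]

theorem gaussTerm_half (k : ℕ) :
    gaussTerm (1 / 2) 1 k = ((2 * k).choose k : ℝ) ^ 2 / 2 ^ (4 * k) := by
  rw [cast_choose_two_mul]
  induction k with
  | zero => simp [gaussTerm_zero]
  | succ k ih =>
    rw [gaussTerm_succ, ih, show 2 * (k + 1) = 2 * k + 1 + 1 by ring]
    simp only [Nat.factorial_succ, pow_mul, pow_succ]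
    push_cast
    field_simp
    ring

theorem gaussTerm_third (k : ℕ) :
    gaussTerm (1 / 3) 1 k =
      ((2 * k).choose k : ℝ) * ((3 * k).choose k : ℝ) / 3 ^ (3 * k) := by
  -- As a single quotient of factorials, the product has a consecutive ratio that is visibly
  -- rational in k.
  have e : ((2 * k).choose k : ℝ) * ((3 * k).choose k : ℝ) =
      (3 * k).factorial / (k.factorial * k.factorial * k.factorial) := by
    rw [cast_choose_two_mul, cast_choose_three_mul]
    field_simp
  rw [e]
  clear e
  induction k with
  | zero => simp [gaussTerm_zero]
  | succ k ih =>
    rw [gaussTerm_succ, ih, show 3 * (k + 1) = 3 * k + 1 + 1 + 1 by ring]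
    simp only [Nat.factorial_succ, pow_mul, pow_succ]
    push_cast
    field_simp
    ring

theorem gaussTerm_quarter (k : ℕ) :
    gaussTerm (1 / 4) 1 k =
      ((2 * k).choose k : ℝ) * ((4 * k).choose (2 * k) : ℝ) / 2 ^ (6 * k) := by
  have e : ((2 * k).choose k : ℝ) * ((4 * k).choose (2 * k) : ℝ) =
      (4 * k).factorial / (k.factorial * k.factorial * (2 * k).factorial) := by
    rw [show 4 * k = 2 * (2 * k) by ring, cast_choose_two_mul, cast_choose_two_mul]
    field_simp
  rw [e]
  clear e
  induction k with
  | zero => simp [gaussTerm_zero]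
  | succ k ih =>
    rw [gaussTerm_succ, ih, show 4 * (k + 1) = 4 * k + 1 + 1 + 1 + 1 by ring,
      show 2 * (k + 1) = 2 * k + 1 + 1 by ring]
    simp only [Nat.factorial_succ, pow_mul, pow_succ]
    push_cast
    field_simp
    ring

theorem gaussTerm_sixth (k : ℕ) :
    gaussTerm (1 / 6) 1 k =
      ((3 * k).choose k : ℝ) * ((6 * k).choose (3 * k) : ℝ) / (2 ^ (4 * k) * 3 ^ (3 * k)) := by
  have e : ((3 * k).choose k : ℝ) * ((6 * k).choose (3 * k) : ℝ) =
      (6 * k).factorial / (k.factorial * (2 * k).factorial * (3 * k).factorial) := by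
    rw [show 6 * k = 2 * (3 * k) by ring, cast_choose_three_mul, cast_choose_two_mul]
    field_simp
  rw [e]
  clear e
  induction k with
  | zero => simp [gaussTerm_zero]
  | succ k ih =>
    rw [gaussTerm_succ, ih, show 6 * (k + 1) = 6 * k + 1 + 1 + 1 + 1 + 1 + 1 by ring,
      show 3 * (k + 1) = 3 * k + 1 + 1 + 1 by ring, show 2 * (k + 1) = 2 * k + 1 + 1 by ring]
    simp only [Nat.factorial_succ, pow_mul, pow_succ]
    push_cast
    field_simp
    ring

/-! ### The two limiting constants for each degree -/

theorem tendsto_gaussHarm_half :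
    Tendsto (fun N => gaussHarm (1 / 2) N - 2 * (harmonic N : ℝ)) atTop (𝓝 (4 * log 2)) := by
  refine ((tendsto_harmonic_mul_sub two_pos).const_mul 4).congr fun N => ?_
  rw [gaussHarm_half]
  ring

theorem tendsto_gaussHarm_third :
    Tendsto (fun N => gaussHarm (1 / 3) N - 2 * (harmonic N : ℝ)) atTop (𝓝 (3 * log 3)) := by
  refine ((tendsto_harmonic_mul_sub three_pos).const_mul 3).congr fun N => ?_
  rw [gaussHarm_third]
  ring

theorem tendsto_gaussHarm_quarter :
    Tendsto (fun N => gaussHarm (1 / 4) N - 2 * (harmonic N : ℝ)) atTop (𝓝 (6 * log 2)) := by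
  have h4 : log 4 = 2 * log 2 := by
    rw [show (4 : ℝ) = 2 ^ 2 by norm_num, log_pow]; norm_num
  have := ((tendsto_harmonic_mul_sub four_pos).const_mul 4).sub
    ((tendsto_harmonic_mul_sub two_pos).const_mul 2)
  push_cast at this
  rw [h4, show 4 * (2 * log 2) - 2 * log 2 = 6 * log 2 by ring] at this
  refine this.congr fun N => ?_
  rw [gaussHarm_quarter]
  ring

theorem tendsto_gaussHarm_sixth :
    Tendsto (fun N => gaussHarm (1 / 6) N - 2 * (harmonic N : ℝ)) atTop
      (𝓝 (4 * log 2 + 3 * log 3)) := by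
  have h6 : log 6 = log 2 + log 3 := by
    rw [show (6 : ℝ) = 2 * 3 by norm_num, log_mul (by norm_num) (by norm_num)]
  have := (((tendsto_harmonic_mul_sub (d := 6) (by norm_num)).const_mul 6).sub
    ((tendsto_harmonic_mul_sub three_pos).const_mul 3)).sub
    ((tendsto_harmonic_mul_sub two_pos).const_mul 2)
  push_cast at this
  rw [h6, show 6 * (log 2 + log 3) - 3 * log 3 - 2 * log 2 = 4 * log 2 + 3 * log 3 by ring] at this
  refine this.congr fun N => ?_
  rw [gaussHarm_sixth]
  ring

/-- Every `harmonicSq (d * N)` tends to π²/6, so only the sum of the coefficients matters. The four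
limits agree with the reflection value π²/sin²(πa). -/
theorem tendsto_sum_sq_half : Tendsto (fun N => ∑ j ∈ range N,
    (1 / ((j : ℝ) + 1 / 2) ^ 2 + 1 / ((j : ℝ) + 1 - 1 / 2) ^ 2)) atTop (𝓝 (π ^ 2)) := by
  have := ((tendsto_harmonicSq_mul two_pos).const_mul 8).sub (tendsto_harmonicSq.const_mul 2)
  simp only [sum_sq_half]
  convert this using 2
  ring

theorem tendsto_sum_sq_third : Tendsto (fun N => ∑ j ∈ range N,
    (1 / ((j : ℝ) + 1 / 3) ^ 2 + 1 / ((j : ℝ) + 1 - 1 / 3) ^ 2)) atTop (𝓝 (4 * π ^ 2 / 3)) := by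
  have := ((tendsto_harmonicSq_mul three_pos).const_mul 9).sub tendsto_harmonicSq
  simp only [sum_sq_third]
  convert this using 2
  ring

theorem tendsto_sum_sq_quarter : Tendsto (fun N => ∑ j ∈ range N,
    (1 / ((j : ℝ) + 1 / 4) ^ 2 + 1 / ((j : ℝ) + 1 - 1 / 4) ^ 2)) atTop (𝓝 (2 * π ^ 2)) := by
  have := ((tendsto_harmonicSq_mul four_pos).const_mul 16).sub
    ((tendsto_harmonicSq_mul two_pos).const_mul 4)
  simp only [sum_sq_quarter]
  convert this using 2
  ring

theorem tendsto_sum_sq_sixth : Tendsto (fun N => ∑ j ∈ range N,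
    (1 / ((j : ℝ) + 1 / 6) ^ 2 + 1 / ((j : ℝ) + 1 - 1 / 6) ^ 2)) atTop (𝓝 (4 * π ^ 2)) := by
  have := ((((tendsto_harmonicSq_mul (d := 6) (by norm_num)).const_mul 36).sub
    ((tendsto_harmonicSq_mul three_pos).const_mul 9)).sub
    ((tendsto_harmonicSq_mul two_pos).const_mul 4)).add tendsto_harmonicSq
  simp only [sum_sq_sixth]
  convert this using 2
  ring

end

/-! ### The four evaluations -/

theorem mainTheorem10 :
    -- degree -1/2
    ((∀ t ∈ Set.Ico (0 : ℝ) 1, Summable fun k : ℕ => lsTermHalf t (k + 1)) ∧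
      IntervalIntegrable (fun t : ℝ => legendreSunHalf t * log (1 - t)) volume 0 1 ∧
      Summable lsHarmonicTermHalf ∧
      -(∫ t in (0 : ℝ)..1, legendreSunHalf t * log (1 - t)) =
        2 * ∑' k : ℕ, lsHarmonicTermHalf k ∧
      2 * ∑' k : ℕ, lsHarmonicTermHalf k =
        96 / π - 8 * π / 3 - 128 * log 2 / π + 64 * log 2 ^ 2 / π) ∧
    -- degree -1/3
    ((∀ t ∈ Set.Ico (0 : ℝ) 1, Summable fun k : ℕ => lsTermThird t (k + 1)) ∧
      IntervalIntegrable (fun t : ℝ => legendreSunThird t * log (1 - t)) volume 0 1 ∧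
      Summable lsHarmonicTermThird ∧
      -(∫ t in (0 : ℝ)..1, legendreSunThird t * log (1 - t)) =
        ∑' k : ℕ, lsHarmonicTermThird k ∧
      ∑' k : ℕ, lsHarmonicTermThird k =
        567 * √3 / (8 * π) - 9 * √3 * π / 4 - 243 * √3 * log 3 / (4 * π)
          + 81 * √3 * log 3 ^ 2 / (4 * π)) ∧
    -- degree -1/4
    ((∀ t ∈ Set.Ico (0 : ℝ) 1, Summable fun k : ℕ => lsTermQuarter t (k + 1)) ∧
      IntervalIntegrable (fun t : ℝ => legendreSunQuarter t * log (1 - t)) volume 0 1 ∧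
      Summable lsHarmonicTermQuarter ∧
      -(∫ t in (0 : ℝ)..1, legendreSunQuarter t * log (1 - t)) =
        2 * ∑' k : ℕ, lsHarmonicTermQuarter k ∧
      2 * ∑' k : ℕ, lsHarmonicTermQuarter k =
        3328 * √2 / (27 * π) - 40 * √2 * π / 9 - 512 * √2 * log 2 / (3 * π)
          + 96 * √2 * log 2 ^ 2 / π) ∧
    -- degree -1/6
    ((∀ t ∈ Set.Ico (0 : ℝ) 1, Summable fun k : ℕ => lsTermSixth t (k + 1)) ∧
      IntervalIntegrable (fun t : ℝ => legendreSunSixth t * log (1 - t)) volume 0 1 ∧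
      Summable lsHarmonicTermSixth ∧
      -(∫ t in (0 : ℝ)..1, legendreSunSixth t * log (1 - t)) =
        ∑' k : ℕ, lsHarmonicTermSixth k ∧
      ∑' k : ℕ, lsHarmonicTermSixth k =
        40176 / (125 * π) - 66 * π / 5 - 5184 * log 2 / (25 * π) - 3888 * log 3 / (25 * π)
          + 288 * log 2 ^ 2 / (5 * π) + 432 * (log 2 * log 3) / (5 * π)
          + 162 * log 3 ^ 2 / (5 * π)) := by
  refine ⟨?_, ?_, ?_, ?_⟩
  -- `r = 2` is the prefactor common to the series and its modulation; it absorbs the factor 2 in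
  -- `gaussHarm_half`.
  · convert! legendreSun_evaluation (a := 1 / 2) (r := 2) (T := lsTermHalf)
      (s := lsHarmonicTermHalf) (by norm_num) (by norm_num) (by norm_num)
      tendsto_gaussHarm_half tendsto_sum_sq_half (fun t k => ?_) (fun k => ?_) using 5
    · rw [show π * (1 / 2) = π / 2 by ring, sin_pi_div_two]
      field_simp
      ring
    · rw [lsTermHalf, gaussTerm_half, gaussHarm_half, div_pow, ← pow_mul]
      ring
    · rw [lsHarmonicTermHalf, gaussTerm_half, gaussHarm_half]
      ring
  · have h := legendreSun_evaluation (a := 1 / 3) (r := 1) (T := lsTermThird)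
      (s := lsHarmonicTermThird) (by norm_num) (by norm_num) (by norm_num)
      tendsto_gaussHarm_third tendsto_sum_sq_third (fun t k => ?_) (fun k => ?_)
    · simp only [one_mul] at h
      convert! h using 5
      rw [show π * (1 / 3) = π / 3 by ring, sin_pi_div_three]
      field_simp
      ring
    · rw [lsTermThird, gaussTerm_third, gaussHarm_third, div_pow, ← pow_mul]
      ring
    · rw [lsHarmonicTermThird, gaussTerm_third, gaussHarm_third]
      ring
  · convert! legendreSun_evaluation (a := 1 / 4) (r := 2) (T := lsTermQuarter)
      (s := lsHarmonicTermQuarter) (by norm_num) (by norm_num) (by norm_num)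
      tendsto_gaussHarm_quarter tendsto_sum_sq_quarter (fun t k => ?_) (fun k => ?_) using 5
    · rw [show π * (1 / 4) = π / 4 by ring, sin_pi_div_four]
      field_simp
      ring
    · rw [lsTermQuarter, gaussTerm_quarter, gaussHarm_quarter, div_pow, ← pow_mul]
      ring
    · rw [lsHarmonicTermQuarter, gaussTerm_quarter, gaussHarm_quarter]
      ring
  · have h := legendreSun_evaluation (a := 1 / 6) (r := 1) (T := lsTermSixth)
      (s := lsHarmonicTermSixth) (by norm_num) (by norm_num) (by norm_num)
      tendsto_gaussHarm_sixth tendsto_sum_sq_sixth (fun t k => ?_) (fun k => ?_)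
    · simp only [one_mul] at h
      convert! h using 5
      rw [show π * (1 / 6) = π / 6 by ring, sin_pi_div_six]
      field_simp
      ring
    · rw [lsTermSixth, gaussTerm_sixth, gaussHarm_sixth, div_pow, mul_pow, ← pow_mul, ← pow_mul]
      ring
    · rw [lsHarmonicTermSixth, gaussTerm_sixth, gaussHarm_sixth]
      ring
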